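/- In the \textsc{Congested Clique} model, $n$ nodes with identifiers $0,\dots,n-1$ communicate in synchronous rounds. In each round every node may send to every other node a (possibly different) message of at most $c\log_2 n$ bits, where $c$ is an absolute constant. Local computation is unrestricted. The input is a simple graph $G$ whose vertices are the $n$ nodes, and every node initially knows only $n$, its own identifier, its neighbours in $G$, and the pattern graph $H$. An algorithm terminates when every node has halted with an output. A copy of $H$ in $G$ is a (not necessarily induced) subgraph of $G$ that is isomorphic to $H$. An algorithm lists all copies of $H$ in $G$ if each node outputs a set of subgraphs and the union of these sets over all nodes is exactly the set of copies of $H$ in $G$. **Theorem.** There is a deterministic \textsc{Congested Clique} algorithm such that, for every graph $G$ with $n$ nodes and $m$ edges and every graph $H$ with $p$ nodes and $k$ edges, where $1\le p\le\log_2 n$, the algorithm terminates and lists all copies of $H$ in $G$ within $$O\!\left(\frac{k\,\tilde m}{n^{1+2/p}}+p\right)$$ rounds, where $\tilde m=\max\{m,\,n^{1+1/p}\}$. The constant hidden in the $O$-notation is absolute; in particular it does not depend on $n$, $m$, $p$, $k$, $G$ or $H$. -/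

import Mathlib

namespace CongestedClique

/-- A message of at most `B` bits. -/
def Message (B : ℕ) : Type := {w : List Bool // w.length ≤ B}

/-- The empty message (what a halted node sends). -/
def Message.empty (B : ℕ) : Message B := ⟨[], Nat.zero_le B⟩

/-- A deterministic algorithm for the Congested Clique with nodes `0, …, n - 1`, in which every
node may send one message of at most `B` bits to each node in every synchronous round.
Local computation is unrestricted. The first argument `Fin n` of every field is the identifier
of the node that acts. -/
structure Algorithm (n B : ℕ) (Out : Type) where
  /-- the local states of a node -/
  State : Type
  /-- the initial state, from the identifier and the input: the neighbours of that vertex -/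
  init : Fin n → Set (Fin n) → State
  /-- `some o` means that the node has halted with output `o`; `none` that it is still running -/
  output : Fin n → State → Option Out
  /-- the message to each recipient, as a function of the local state -/
  send : Fin n → State → Fin n → Message B
  /-- the new state, from the local state and the messages received (indexed by their senders) -/
  receive : Fin n → State → (Fin n → Message B) → State

namespace Algorithm

variable {n B : ℕ} {Out : Type}

/-- The message from `u` to `v` in the next round, given the current states of all nodes. -/
def transmitted (A : Algorithm n B Out) (s : Fin n → A.State) (u v : Fin n) : Message B :=
  match A.output u (s u) with
  | some _ => Message.empty B
  | none => A.send u (s u) v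

/-- One synchronous round. The state of a node that has halted no longer changes. -/
def step (A : Algorithm n B Out) (s : Fin n → A.State) : Fin n → A.State := fun v =>
  match A.output v (s v) with
  | some _ => s v
  | none => A.receive v (s v) (fun u => A.transmitted s u v)

/-- The states of all nodes after `t` rounds on the input graph `G`. -/
def run (A : Algorithm n B Out) (G : SimpleGraph (Fin n)) : ℕ → Fin n → A.State
  | 0 => fun v => A.init v (G.neighborSet v)
  | t + 1 => A.step (A.run G t)

/-- On input `G`, after `t` rounds every node `v` has halted, with output `out v`. -/
def HaltsWith (A : Algorithm n B Out) (G : SimpleGraph (Fin n)) (t : ℕ) (out : Fin n → Out) :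
    Prop :=
  ∀ v, A.output v (A.run G t v) = some (out v)

end Algorithm

/-- A subgraph on vertices among the `n` nodes (a vertex set together with an edge set on it),
as a value that does not refer to the input graph. -/
abbrev Candidate (n : ℕ) : Type := (⊤ : SimpleGraph (Fin n)).Subgraph

/-- The copies of `H` in `G`: the (not necessarily induced) subgraphs of `G` that are isomorphic
to `H`. -/
def copies {n p : ℕ} (H : SimpleGraph (Fin p)) (G : SimpleGraph (Fin n)) : Set (Candidate n) :=
  {S | (∀ u v, S.Adj u v → G.Adj u v) ∧ Nonempty (H ≃g S.coe)}

/-- On input `G`, the algorithm terminates within `T` rounds, and every node then outputs a set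
of subgraphs such that the union of these sets is exactly the set of copies of `H` in `G`. -/
def ListsWithin {n p B : ℕ} (A : Algorithm n B (Set (Candidate n))) (H : SimpleGraph (Fin p))
    (G : SimpleGraph (Fin n)) (T : ℝ) : Prop :=
  ∃ (t : ℕ) (out : Fin n → Set (Candidate n)),
    (t : ℝ) ≤ T ∧ A.HaltsWith G t out ∧ ⋃ v, out v = copies H G

/-- `m̃ = max {m, n ^ (1 + 1 / p)}`, where `m` is the number of edges of `G`. -/
noncomputable def mTilde {n : ℕ} (G : SimpleGraph (Fin n)) (p : ℕ) : ℝ :=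
  max (G.edgeSet.ncard : ℝ) ((n : ℝ) ^ (1 + 1 / (p : ℝ)))

end CongestedClique

namespace CongestedClique

open Finset

/-- What the nodes know about the world: `K v ω ω'` says that node `v` cannot tell the worlds
`ω` and `ω'` apart. -/
abbrev Knowledge (V Ω : Type) : Type := V → Ω → Ω → Prop

variable {V Ω : Type}

/-- One round, with messages that are numbers below `W`, leads from `K` to `K'`. -/
def Step (W : ℕ) (K K' : Knowledge V Ω) : Prop :=
  ∃ msg : V → V → Ω → ℕ, (∀ u v ω, msg u v ω < W) ∧
    (∀ u v ω ω', K u ω ω' → msg u v ω = msg u v ω') ∧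
    ∀ v ω ω', K v ω ω' → (∀ u, msg u v ω = msg u v ω') → K' v ω ω'

/-- `r` rounds lead from `K` to `K'`. -/
inductive Reach (W : ℕ) : ℕ → Knowledge V Ω → Knowledge V Ω → Prop
  | refl {K K' : Knowledge V Ω} : (∀ v ω ω', K v ω ω' → K' v ω ω') → Reach W 0 K K'
  | step {r : ℕ} {K K₁ K' : Knowledge V Ω} :
      Step W K K₁ → Reach W r K₁ K' → Reach W (r + 1) K K'

theorem Step.mono_left {W : ℕ} {K K₀ K' : Knowledge V Ω} (h : Step W K K')
    (h0 : ∀ v ω ω', K₀ v ω ω' → K v ω ω') : Step W K₀ K' := by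
  obtain ⟨msg, h1, h2, h3⟩ := h
  exact ⟨msg, h1, fun u v ω ω' h => h2 u v ω ω' (h0 _ _ _ h),
    fun v ω ω' h => h3 v ω ω' (h0 _ _ _ h)⟩

theorem Reach.mono_left {W r : ℕ} {K K₀ K' : Knowledge V Ω} (h : Reach W r K K')
    (h0 : ∀ v ω ω', K₀ v ω ω' → K v ω ω') : Reach W r K₀ K' := by
  cases h with
  | refl h => exact .refl fun v ω ω' hk => h _ _ _ (h0 _ _ _ hk)
  | step h hr => exact .step (h.mono_left h0) hr

theorem Reach.trans {W r s : ℕ} {K K₁ K' : Knowledge V Ω} (h : Reach W r K K₁)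
    (h' : Reach W s K₁ K') : Reach W (r + s) K K' := by
  induction h with
  | refl h => simpa using h'.mono_left h
  | step h _ ih => rw [Nat.add_right_comm]; exact .step h (ih h')

theorem Reach.mono_right {W r : ℕ} {K K₁ K' : Knowledge V Ω} (h : Reach W r K K₁)
    (h' : ∀ v ω ω', K₁ v ω ω' → K' v ω ω') : Reach W r K K' :=
  h.trans (.refl h')

theorem Reach.idle {W r : ℕ} (hW : 0 < W) (K : Knowledge V Ω) : Reach W r K K := by
  induction r with
  | zero => exact .refl fun _ _ _ h => h
  | succ r ih =>
    exact .step ⟨fun _ _ _ => 0, fun _ _ _ => hW, fun _ _ _ _ _ => rfl, fun _ _ _ h _ => h⟩ ih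

theorem Reach.mono_rounds {W r s : ℕ} {K K' : Knowledge V Ω} (hW : 0 < W) (h : Reach W r K K')
    (hrs : r ≤ s) : Reach W s K K' := by
  obtain ⟨d, rfl⟩ := Nat.exists_eq_add_of_le hrs
  exact h.trans (.idle hW K')

/-- Every node `u` sends `r` words to every node `v`. -/
theorem Reach.words {W : ℕ} (r : ℕ) {K : Knowledge V Ω} (w : V → V → ℕ → Ω → ℕ)
    (hw : ∀ u v i ω, w u v i ω < W)
    (hK : ∀ u v i ω ω', K u ω ω' → w u v i ω = w u v i ω') :
    Reach W r K (fun v ω ω' => K v ω ω' ∧ ∀ u, ∀ i < r, w u v i ω = w u v i ω') := by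
  induction r with
  | zero => exact .refl fun _ _ _ h => ⟨h, fun _ _ h => absurd h (Nat.not_lt_zero _)⟩
  | succ r ih =>
    refine ih.trans (.step ⟨fun u v ω => w u v r ω, fun u v ω => hw _ _ _ _,
      fun u v ω ω' h => hK _ _ _ _ _ h.1, fun v ω ω' h h' => ?_⟩ (.refl fun _ _ _ h => h))
    refine ⟨h.1, fun u i hi => ?_⟩
    rcases Nat.lt_succ_iff_lt_or_eq.mp hi with hi | rfl
    · exact h.2 u i hi
    · exact h' u

/-- Every node `u` sends one word to every node `v`. -/
theorem Reach.word {W : ℕ} {K : Knowledge V Ω} (w : V → V → Ω → ℕ)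
    (hw : ∀ u v ω, w u v ω < W)
    (hK : ∀ u v ω ω', K u ω ω' → w u v ω = w u v ω') :
    Reach W 1 K (fun v ω ω' => K v ω ω' ∧ ∀ u, w u v ω = w u v ω') :=
  .step ⟨w, hw, hK, fun _ _ _ h h' => ⟨h, h'⟩⟩ (.refl fun _ _ _ h => h)

/-- A word for an optional element of a finite type. -/
noncomputable def optionCode {P : Type} [Fintype P] : Option P → ℕ
  | none => 0
  | some p => Fintype.equivFin P p + 1

theorem optionCode_injective {P : Type} [Fintype P] :
    Function.Injective (optionCode (P := P)) := by
  rintro (_ | p) (_ | p') h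
  · rfl
  · simp [optionCode] at h
  · simp [optionCode] at h
  · simp only [optionCode, Nat.add_right_cancel_iff, Fin.val_inj] at h
    rw [(Fintype.equivFin P).injective h]

theorem optionCode_lt {P : Type} [Fintype P] (o : Option P) :
    optionCode o < Fintype.card P + 1 := by
  rcases o with _ | p
  · simp [optionCode]
  · simp [optionCode]

/-- Every node `u` sends a set of at most `r` packets to every node `v`. -/
theorem Reach.packets {P : Type} [Fintype P] {W r : ℕ} {K : Knowledge V Ω}
    (Q : V → V → Ω → Finset P) (hW : Fintype.card P < W) (hQ : ∀ u v ω, #(Q u v ω) ≤ r)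
    (hK : ∀ u v ω ω', K u ω ω' → Q u v ω = Q u v ω') :
    Reach W r K (fun v ω ω' => K v ω ω' ∧ ∀ u, Q u v ω = Q u v ω') := by
  refine (Reach.words (W := W) r (K := K) (fun u v i ω => optionCode ((Q u v ω).toList[i]?))
    (fun u v i ω => lt_of_lt_of_le (optionCode_lt _) hW)
    (fun u v i ω ω' h => by simp only [hK u v ω ω' h])).mono_right ?_
  rintro v ω ω' ⟨h, h'⟩
  refine ⟨h, fun u => ?_⟩
  have : (Q u v ω).toList = (Q u v ω').toList := by
    apply List.ext_getElem?
    intro i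
    by_cases hi : i < r
    · exact optionCode_injective (h' u i hi)
    · have h1 := hQ u v ω
      have h2 := hQ u v ω'
      rw [List.getElem?_eq_none (by rw [Finset.length_toList]; omega),
        List.getElem?_eq_none (by rw [Finset.length_toList]; omega)]
  ext p
  rw [← Finset.mem_toList, this, Finset.mem_toList]

/-- Virtual nodes `V'` are simulated by the nodes `V`, each of which hosts at most `h` of them. -/
theorem Reach.simulate {V' : Type} {W r h : ℕ} {K K' : Knowledge V' Ω} (hW : 0 < W)
    (host : V' → V) (label : V' → Fin h)
    (hinj : ∀ u v, host u = host v → label u = label v → u = v) (hr : Reach W r K K') :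
    Reach W (h * h * r) (fun v ω ω' => ∀ x, host x = v → K x ω ω')
      (fun v ω ω' => ∀ x, host x = v → K' x ω ω') := by
  classical
  induction hr with
  | refl hK => exact .refl fun v ω ω' hv x hx => hK _ _ _ (hv x hx)
  | @step r K K₁ K' hs _ ih =>
    obtain ⟨msg, h1, h2, h3⟩ := hs
    rw [Nat.mul_add, Nat.mul_one, Nat.add_comm]
    refine Reach.trans ?_ ih
    let w : V → V → ℕ → Ω → ℕ := fun u v i ω =>
      if hx : ∃ xy : V' × V', host xy.1 = u ∧ host xy.2 = v ∧
          i = finProdFinEquiv (label xy.1, label xy.2) then msg hx.choose.1 hx.choose.2 ω else 0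
    have hw : ∀ x y ω, w (host x) (host y) (finProdFinEquiv (label x, label y)) ω = msg x y ω := by
      intro x y ω
      have hx : ∃ xy : V' × V', host xy.1 = host x ∧ host xy.2 = host y ∧
          (finProdFinEquiv (label x, label y) : ℕ) = finProdFinEquiv (label xy.1, label xy.2) :=
        ⟨(x, y), rfl, rfl, rfl⟩
      have hs := hx.choose_spec
      have h3 := hs.2.2
      rw [Fin.val_inj, finProdFinEquiv.apply_eq_iff_eq, Prod.mk.injEq] at h3
      simp only [w, dif_pos hx]
      rw [hinj _ _ hs.1 h3.1.symm, hinj _ _ hs.2.1 h3.2.symm]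
    refine (Reach.words (W := W) (h * h) w ?_ ?_).mono_right ?_
    · intro u v i ω
      simp only [w]
      split_ifs
      · exact h1 _ _ _
      · exact hW
    · intro u v i ω ω' hK
      simp only [w]
      split_ifs with hx
      · exact h2 _ _ _ _ (hK _ hx.choose_spec.1)
      · rfl
    · rintro v ω ω' ⟨hK, hv⟩ y rfl
      refine h3 _ _ _ (hK y rfl) fun x => ?_
      rw [← hw, ← hw]
      exact hv _ _ (Fin.is_lt _)

theorem card_filter_mod_le {α : Type*} (s : Finset α) (f : α → ℕ) {L : ℕ} (N z : ℕ)
    (hf : Set.InjOn f s) (hL : ∀ p ∈ s, f p < L) : #{p ∈ s | f p % N = z} ≤ L / N + 1 := by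
  rw [← card_range (L / N + 1)]
  refine card_le_card_of_injOn (fun p => f p / N) (fun p hp => ?_) fun p hp p' hp' h => ?_
  · simp only [coe_filter, Set.mem_ofPred_eq] at hp
    simp only [coe_range, Set.mem_Iio]
    exact Nat.lt_succ_of_le (Nat.div_le_div_right (hL p hp.1).le)
  · simp only [coe_filter, Set.mem_ofPred_eq] at hp hp'
    refine hf hp.1 hp'.1 ?_
    rw [← Nat.div_add_mod (f p) N, ← Nat.div_add_mod (f p') N, hp.2, hp'.2]
    simp only at h
    rw [h]

open Classical in
/-- The rank of an element of a finite set, in some enumeration of this set. -/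
noncomputable def rank {P : Type} (s : Finset P) (p : P) : ℕ := s.toList.idxOf p

theorem rank_lt {P : Type} {s : Finset P} {p : P} (hp : p ∈ s) : rank s p < #s := by
  classical
  rw [← Finset.length_toList]
  exact List.idxOf_lt_length_of_mem (Finset.mem_toList.mpr hp)

theorem rank_injOn {P : Type} (s : Finset P) : Set.InjOn (rank s) s := by
  classical
  intro p hp p' _ h
  exact (List.idxOf_inj (Finset.mem_toList.mpr hp)).mp h

/-- The position of `p ∈ s i` in the concatenation of the sets `s i`. -/
noncomputable def position {m : ℕ} {P : Type} (s : Fin m → Finset P) (i : Fin m) (p : P) : ℕ :=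
  ∑ j ∈ Finset.Iio i, #(s j) + rank (s i) p

theorem position_lt_of_lt {m : ℕ} {P : Type} {s : Fin m → Finset P} {i j : Fin m} (h : i < j)
    {p : P} (hp : p ∈ s i) (p' : P) : position s i p < position s j p' := by
  have h1 : ∑ j ∈ Finset.Iio i, #(s j) + #(s i) ≤ ∑ j ∈ Finset.Iio j, #(s j) := by
    rw [add_comm, ← Finset.sum_insert (f := fun j => #(s j)) (s := Iio i) (a := i) (by simp)]
    refine Finset.sum_le_sum_of_subset ?_
    intro x hx
    simp only [mem_insert, mem_Iio] at hx ⊢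
    rcases hx with rfl | hx
    · exact h
    · exact hx.trans h
  have := rank_lt hp
  unfold position
  omega

theorem position_inj {m : ℕ} {P : Type} {s : Fin m → Finset P} {i j : Fin m} {p p' : P}
    (hp : p ∈ s i) (hp' : p' ∈ s j) (h : position s i p = position s j p') : i = j ∧ p = p' := by
  rcases lt_trichotomy i j with hij | rfl | hij
  · exact absurd h (position_lt_of_lt hij hp p').ne
  · exact ⟨rfl, rank_injOn _ hp hp' (by simpa [position] using h)⟩
  · exact absurd h (position_lt_of_lt hij hp' p).ne'

theorem position_lt {m : ℕ} {P : Type} {s : Fin m → Finset P} {i : Fin m} {p : P}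
    (hp : p ∈ s i) : position s i p < ∑ j, #(s j) := by
  have h1 : ∑ j ∈ Finset.Iio i, #(s j) + #(s i) ≤ ∑ j, #(s j) := by
    rw [add_comm, ← Finset.sum_insert (f := fun j => #(s j)) (s := Iio i) (a := i) (by simp)]
    exact Finset.sum_le_sum_of_subset (subset_univ _)
  have := rank_lt hp
  unfold position
  omega

/-- Greedy edge colouring of a bipartite multigraph of maximum degree `L` with `2 L` colours. -/
theorem exists_greedy_colouring {α X Y : Type*} [DecidableEq X] [DecidableEq Y]
    (left : α → X) (right : α → Y) (L : ℕ) (s : Finset α)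
    (hl : ∀ x, #{e ∈ s | left e = x} ≤ L) (hr : ∀ y, #{e ∈ s | right e = y} ≤ L) :
    ∃ κ : α → ℕ, (∀ e ∈ s, κ e < 2 * L) ∧
      ∀ e ∈ s, ∀ e' ∈ s, left e = left e' ∨ right e = right e' → κ e = κ e' → e = e' := by
  classical
  induction s using Finset.induction_on with
  | empty => exact ⟨fun _ => 0, by simp, by simp⟩
  | @insert a s ha ih =>
    obtain ⟨κ, h1, h2⟩ := ih
      (fun x => (card_le_card (filter_subset_filter _ (subset_insert a s))).trans (hl x))
      (fun x => (card_le_card (filter_subset_filter _ (subset_insert a s))).trans (hr x))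
    have hl' := hl (left a)
    have hr' := hr (right a)
    rw [filter_insert, if_pos rfl, card_insert_of_notMem (by simp [ha])] at hl' hr'
    have : ∃ c ∈ range (2 * L), c ∉ image κ {e ∈ s | left e = left a} ∪
        image κ {e ∈ s | right e = right a} := by
      apply exists_mem_notMem_of_card_lt_card
      have := card_union_le (image κ {e ∈ s | left e = left a})
        (image κ {e ∈ s | right e = right a})
      have := card_image_le (f := κ) (s := {e ∈ s | left e = left a})
      have := card_image_le (f := κ) (s := {e ∈ s | right e = right a})
      rw [card_range]
      omega
    obtain ⟨c, hc, hc'⟩ := this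
    have hc'' : ∀ e ∈ s, left e = left a ∨ right e = right a → κ e ≠ c := by
      rintro e he h rfl
      apply hc'
      rw [mem_union, mem_image, mem_image]
      rcases h with h | h
      · exact .inl ⟨e, mem_filter.mpr ⟨he, h⟩, rfl⟩
      · exact .inr ⟨e, mem_filter.mpr ⟨he, h⟩, rfl⟩
    have hne : ∀ e ∈ s, e ≠ a := fun e he h => ha (h ▸ he)
    refine ⟨Function.update κ a c, fun e he => ?_, fun e he e' he' hee hκ => ?_⟩
    · rcases mem_insert.mp he with rfl | he
      · simpa using hc
      · rw [Function.update_of_ne (hne e he)]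
        exact h1 e he
    · rcases mem_insert.mp he with hea | hes <;> rcases mem_insert.mp he' with hea' | hes'
      · exact hea.trans hea'.symm
      · subst hea
        rw [Function.update_self, Function.update_of_ne (hne e' hes')] at hκ
        exact absurd hκ.symm (hc'' e' hes' (hee.imp Eq.symm Eq.symm))
      · subst hea'
        rw [Function.update_self, Function.update_of_ne (hne e hes)] at hκ
        exact absurd hκ (hc'' e hes hee)
      · rw [Function.update_of_ne (hne e hes), Function.update_of_ne (hne e' hes')] at hκ
        exact h2 e hes e' hes' hee hκ

/-- The same for a multigraph given by its matrix of multiplicities. -/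
theorem exists_matrix_colouring {X : Type} [Fintype X] [DecidableEq X] (L : ℕ)
    (m : X → X → ℕ) (hl : ∀ x, ∑ y, m x y ≤ L) (hr : ∀ y, ∑ x, m x y ≤ L) :
    ∃ κ : X → X → ℕ → ℕ, (∀ x y, ∀ i < m x y, κ x y i < 2 * L) ∧
      (∀ x y y', ∀ i < m x y, ∀ i' < m x y', κ x y i = κ x y' i' → y = y' ∧ i = i') ∧
      ∀ x x' y, ∀ i < m x y, ∀ i' < m x' y, κ x y i = κ x' y i' → x = x' ∧ i = i' := by
  let s : Finset (Σ _ : X × X, ℕ) := univ.sigma fun xy => range (m xy.1 xy.2)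
  have hs : ∀ x y i, (⟨(x, y), i⟩ : Σ _ : X × X, ℕ) ∈ s ↔ i < m x y := by simp [s]
  have hs1 : ∀ x, #{e ∈ s | e.1.1 = x} ≤ L := by
    intro x
    refine le_trans (le_of_eq ?_) (hl x)
    have : {e ∈ s | e.1.1 = x} = (univ.filter fun xy : X × X => xy.1 = x).sigma
        fun xy => range (m xy.1 xy.2) := by
      ext ⟨⟨a, b⟩, i⟩; simp [s, and_comm]
    rw [this, card_sigma]
    simp only [card_range]
    rw [sum_filter, ← univ_product_univ, sum_product]
    simp [Finset.sum_ite_irrel]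
  have hs2 : ∀ y, #{e ∈ s | e.1.2 = y} ≤ L := by
    intro y
    refine le_trans (le_of_eq ?_) (hr y)
    have : {e ∈ s | e.1.2 = y} = (univ.filter fun xy : X × X => xy.2 = y).sigma
        fun xy => range (m xy.1 xy.2) := by
      ext ⟨⟨a, b⟩, i⟩; simp [s, and_comm]
    rw [this, card_sigma]
    simp only [card_range]
    rw [sum_filter, ← univ_product_univ, sum_product]
    simp
  obtain ⟨κ, h1, h2⟩ := exists_greedy_colouring (fun e : Σ _ : X × X, ℕ => e.1.1)
    (fun e => e.1.2) L s hs1 hs2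
  refine ⟨fun x y i => κ ⟨(x, y), i⟩, fun x y i hi => h1 _ ((hs _ _ _).mpr hi),
    fun x y y' i hi i' hi' h => ?_, fun x x' y i hi i' hi' h => ?_⟩
  · have := h2 _ ((hs _ _ _).mpr hi) _ ((hs _ _ _).mpr hi') (.inl rfl) h
    simp only [Sigma.mk.injEq, Prod.mk.injEq, true_and, heq_eq_eq] at this
    exact this
  · have := h2 _ ((hs _ _ _).mpr hi) _ ((hs _ _ _).mpr hi') (.inr rfl) h
    simp only [Sigma.mk.injEq, Prod.mk.injEq, and_true, heq_eq_eq] at this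
    exact this

/-- The packets of `A ω` that are at node `v`. -/
def held {V Ω P : Type} [DecidableEq V] (A : Ω → Finset P) (loc : Ω → P → V) (v : V) (ω : Ω) :
    Finset P := {p ∈ A ω | loc ω p = v}

theorem mem_held {V Ω P : Type} [DecidableEq V] {A : Ω → Finset P} {loc : Ω → P → V} {v : V}
    {ω : Ω} {p : P} : p ∈ held A loc v ω ↔ p ∈ A ω ∧ loc ω p = v := by
  simp [held]

variable {V Ω P : Type} [Fintype V] [DecidableEq V] [Fintype P]

/-- Packets move from `loc` to `loc'` through `mid`. -/
theorem Reach.relay [Nonempty V] {W r : ℕ} {K : Knowledge V Ω} (A : Ω → Finset P) (loc mid loc' : Ω → P → V)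
    (hW : Fintype.card (P × V) < W)
    (hheld : ∀ v ω ω', K v ω ω' → held A loc v ω = held A loc v ω')
    (hmid : ∀ v ω ω', K v ω ω' → ∀ p ∈ held A loc v ω,
      mid ω p = mid ω' p ∧ loc' ω p = loc' ω' p)
    (h1 : ∀ ω u z, #{p ∈ held A loc u ω | mid ω p = z} ≤ r)
    (h2 : ∀ ω v z, #{p ∈ held A loc' v ω | mid ω p = z} ≤ r) :
    Reach W (r + r) K (fun v ω ω' => K v ω ω' ∧ held A loc' v ω = held A loc' v ω') := by
  classical
  have hW' : Fintype.card P < W := by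
    obtain ⟨v⟩ := ‹Nonempty V›
    refine lt_of_le_of_lt ?_ hW
    exact Fintype.card_le_of_injective (fun p => (p, v)) fun p p' h => (Prod.mk.inj h).1
  let Q : V → V → Ω → Finset (P × V) := fun u z ω =>
    image (fun p => (p, loc' ω p)) {p ∈ held A loc u ω | mid ω p = z}
  let Q' : V → V → Ω → Finset P := fun z v ω => {p ∈ held A loc' v ω | mid ω p = z}
  have hQ : ∀ z v ω p, p ∈ Q' z v ω ↔ ∃ u, (p, v) ∈ Q u z ω := by
    intro z v ω p
    simp only [Q, Q', mem_filter, mem_held, mem_image, Prod.mk.injEq]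
    constructor
    · rintro ⟨⟨hp, hv⟩, hz⟩
      exact ⟨loc ω p, p, ⟨⟨hp, rfl⟩, hz⟩, rfl, hv⟩
    · rintro ⟨u, p', ⟨⟨hp, hv⟩, hz⟩, rfl, hv'⟩
      exact ⟨⟨hp, hv'⟩, hz⟩
  refine Reach.trans (Reach.packets (W := W) (r := r) Q hW
    (fun u z ω => card_image_le.trans (h1 ω u z)) ?_)
    ((Reach.packets (W := W) (r := r) Q' hW' (fun z v ω => h2 ω v z) ?_).mono_right ?_)
  · intro u z ω ω' h
    have h' := hmid u ω ω' h
    ext ⟨p, v⟩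
    simp only [Q, mem_filter, mem_image, Prod.mk.injEq, ← hheld u ω ω' h]
    constructor
    · rintro ⟨p, ⟨hp, hz⟩, rfl, hv⟩
      exact ⟨p, ⟨hp, (h' p hp).1 ▸ hz⟩, rfl, (h' p hp).2 ▸ hv⟩
    · rintro ⟨p, ⟨hp, hz⟩, rfl, hv⟩
      exact ⟨p, ⟨hp, (h' p hp).1 ▸ hz⟩, rfl, (h' p hp).2 ▸ hv⟩
  · rintro z v ω ω' ⟨_, h⟩
    ext p
    simp only [hQ, h]
  · rintro v ω ω' ⟨⟨h, _⟩, h'⟩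
    refine ⟨h, ?_⟩
    ext p
    have key : ∀ ω, p ∈ held A loc' v ω ↔ ∃ z, p ∈ Q' z v ω := by
      intro ω
      simp [Q']
    simp only [key, h']

/-- Packets move from `loc` to `loc'`; the packets at a node have distinct colours, before
as well as after the move. -/
theorem Reach.coloured [Nonempty V] {W L : ℕ} {K : Knowledge V Ω} (A : Ω → Finset P)
    (loc loc' : Ω → P → V) (col : Ω → P → ℕ) (hW : Fintype.card (P × V) < W)
    (hheld : ∀ v ω ω', K v ω ω' → held A loc v ω = held A loc v ω')
    (hcol : ∀ v ω ω', K v ω ω' → ∀ p ∈ held A loc v ω,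
      col ω p = col ω' p ∧ loc' ω p = loc' ω' p)
    (hL : ∀ ω, ∀ p ∈ A ω, col ω p < L)
    (h1 : ∀ ω u, Set.InjOn (col ω) (held A loc u ω))
    (h2 : ∀ ω u, Set.InjOn (col ω) (held A loc' u ω)) :
    Reach W (2 * (L / Fintype.card V + 1)) K
      (fun v ω ω' => K v ω ω' ∧ held A loc' v ω = held A loc' v ω') := by
  have hN : 0 < Fintype.card V := Fintype.card_pos
  let mid : Ω → P → V := fun ω p =>
    (Fintype.equivFin V).symm ⟨col ω p % Fintype.card V, Nat.mod_lt _ hN⟩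
  have hmid : ∀ ω p z, mid ω p = z ↔ col ω p % Fintype.card V = Fintype.equivFin V z := by
    intro ω p z
    rw [Equiv.symm_apply_eq, Fin.ext_iff]
  rw [two_mul]
  refine Reach.relay A loc mid loc' hW hheld (fun v ω ω' h p hp => ?_) ?_ ?_
  · have := hcol v ω ω' h p hp
    exact ⟨by simp only [mid, this.1], this.2⟩
  · intro ω u z
    simp only [hmid]
    exact card_filter_mod_le _ _ _ _ (h1 ω u) fun p hp => hL ω p (mem_held.mp hp).1
  · intro ω u z
    simp only [hmid]
    exact card_filter_mod_le _ _ _ _ (h2 ω u) fun p hp => hL ω p (mem_held.mp hp).1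

/-- The nodes form a square grid. Packets move within rows, and all nodes of a row know a
matrix that bounds the number of packets from each node of the row to each other one. -/
theorem Reach.rows {D : Type} [Fintype D] [DecidableEq D] [Nonempty V] {W L N : ℕ}
    (hN : Fintype.card V = N) {K : Knowledge V Ω} (A : Ω → Finset P) (e : D × D ≃ V) (row : Ω → P → D) (c c' : Ω → P → D)
    (M : Ω → D → D → D → ℕ) (hW : Fintype.card (P × V) < W)
    (hheld : ∀ v ω ω', K v ω ω' →
      held A (fun ω p => e (row ω p, c ω p)) v ω = held A (fun ω p => e (row ω p, c ω p)) v ω')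
    (hK : ∀ v ω ω', K v ω ω' → ∀ p ∈ held A (fun ω p => e (row ω p, c ω p)) v ω,
      c' ω p = c' ω' p)
    (hM : ∀ a b ω ω', K (e (a, b)) ω ω' → M ω a = M ω' a)
    (hcard : ∀ ω a b b', #{p ∈ A ω | row ω p = a ∧ c ω p = b ∧ c' ω p = b'} ≤ M ω a b b')
    (hrow : ∀ ω a b, ∑ b', M ω a b b' ≤ L) (hcolumn : ∀ ω a b', ∑ b, M ω a b b' ≤ L) :
    Reach W (2 * (2 * L / N + 1)) K (fun v ω ω' => K v ω ω' ∧
      held A (fun ω p => e (row ω p, c' ω p)) v ω =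
        held A (fun ω p => e (row ω p, c' ω p)) v ω') := by
  classical
  subst hN
  have hex : ∀ m : D → D → ℕ, ∃ κ : D → D → ℕ → ℕ, (∀ x, ∑ y, m x y ≤ L) →
      (∀ y, ∑ x, m x y ≤ L) → (∀ x y, ∀ i < m x y, κ x y i < 2 * L) ∧
      (∀ x y y', ∀ i < m x y, ∀ i' < m x y', κ x y i = κ x y' i' → y = y' ∧ i = i') ∧
      ∀ x x' y, ∀ i < m x y, ∀ i' < m x' y, κ x y i = κ x' y i' → x = x' ∧ i = i' := by
    intro m
    by_cases hm : (∀ x, ∑ y, m x y ≤ L) ∧ ∀ y, ∑ x, m x y ≤ L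
    · obtain ⟨κ, h⟩ := exists_matrix_colouring L m hm.1 hm.2
      exact ⟨κ, fun _ _ => h⟩
    · exact ⟨fun _ _ _ => 0, fun h h' => absurd ⟨h, h'⟩ hm⟩
  choose κ hκ using hex
  let cls : Ω → D → D → D → Finset P := fun ω a b b' =>
    {p ∈ A ω | row ω p = a ∧ c ω p = b ∧ c' ω p = b'}
  let idx : Ω → P → ℕ := fun ω p => rank (cls ω (row ω p) (c ω p) (c' ω p)) p
  have hcls : ∀ ω, ∀ p ∈ A ω, p ∈ cls ω (row ω p) (c ω p) (c' ω p) := by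
    intro ω p hp
    simp [cls, hp]
  have hidx : ∀ ω, ∀ p ∈ A ω, idx ω p < M ω (row ω p) (c ω p) (c' ω p) := fun ω p hp =>
    (rank_lt (hcls ω p hp)).trans_le (hcard _ _ _ _)
  have hloc : ∀ {a b a' b'}, e (a, b) = e (a', b') → a = a' ∧ b = b' := by
    intro a b a' b' h
    exact Prod.mk.inj (e.injective h)
  refine Reach.coloured A _ _ (fun ω p => κ (M ω (row ω p)) (c ω p) (c' ω p) (idx ω p)) hW hheld
    ?_ ?_ ?_ ?_
  · intro v ω ω' h p hp
    have hp' := hp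
    rw [hheld v ω ω' h] at hp'
    have h3 := hK v ω ω' h p hp
    obtain ⟨h1, rfl⟩ := mem_held.mp hp
    obtain ⟨h2, h4⟩ := mem_held.mp hp'
    obtain ⟨h5, h6⟩ := hloc h4
    have h7 := hM _ _ _ _ h
    have h8 : cls ω (row ω p) (c ω p) (c' ω p) = cls ω' (row ω p) (c ω p) (c' ω p) := by
      have h9 := hheld _ ω ω' h
      ext p'
      have h10 : p' ∈ A ω ∧ row ω p' = row ω p ∧ c ω p' = c ω p ↔
          p' ∈ A ω' ∧ row ω' p' = row ω p ∧ c ω' p' = c ω p := by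
        have := Finset.ext_iff.mp h9 p'
        simpa only [mem_held, e.apply_eq_iff_eq, Prod.mk.injEq] using this
      simp only [cls, mem_filter]
      constructor
      · rintro ⟨hA, ha, hb, hc⟩
        obtain ⟨hA', ha', hb'⟩ := h10.mp ⟨hA, ha, hb⟩
        refine ⟨hA', ha', hb', ?_⟩
        rw [← hK _ _ _ h p' (mem_held.mpr ⟨hA, by rw [ha, hb]⟩), hc]
      · rintro ⟨hA, ha, hb, hc⟩
        obtain ⟨hA', ha', hb'⟩ := h10.mpr ⟨hA, ha, hb⟩
        refine ⟨hA', ha', hb', ?_⟩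
        rw [hK _ _ _ h p' (mem_held.mpr ⟨hA', by rw [ha', hb']⟩), hc]
    simp only [idx, h5, h6, ← h3, ← h7, h8, and_self]
  · intro ω p hp
    exact (hκ _ (hrow _ _) (hcolumn _ _)).1 _ _ _ (hidx ω p hp)
  · intro ω u p hp p' hp' h
    obtain ⟨h1, rfl⟩ := mem_held.mp (mem_coe.mp hp)
    obtain ⟨h2, h4⟩ := mem_held.mp (mem_coe.mp hp')
    obtain ⟨h5, h6⟩ := hloc h4
    have i1 := hidx ω p h1
    have i2 := hidx ω p' h2
    have j1 := hcls ω p h1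
    have j2 := hcls ω p' h2
    simp only [idx, h5, h6] at h i1 i2 j1 j2
    obtain ⟨k1, k2⟩ := (hκ _ (hrow _ _) (hcolumn _ _)).2.1 _ _ _ _ i1 _ i2 h
    rw [← k1] at k2 j2
    exact rank_injOn _ j1 j2 k2
  · intro ω u p hp p' hp' h
    obtain ⟨h1, rfl⟩ := mem_held.mp (mem_coe.mp hp)
    obtain ⟨h2, h4⟩ := mem_held.mp (mem_coe.mp hp')
    obtain ⟨h5, h6⟩ := hloc h4
    have i1 := hidx ω p h1
    have i2 := hidx ω p' h2
    have j1 := hcls ω p h1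
    have j2 := hcls ω p' h2
    simp only [idx, h5, h6] at h i1 i2 j1 j2
    obtain ⟨k1, k2⟩ := (hκ _ (hrow _ _) (hcolumn _ _)).2.2 _ _ _ _ i1 _ i2 h
    rw [← k1] at k2 j2
    exact rank_injOn _ j1 j2 k2

theorem sum_card_filter_and_eq {P X : Type} [Fintype X] [DecidableEq X] (s : Finset P)
    (Q : P → Prop) [DecidablePred Q] (f : P → X) :
    ∑ x, #{p ∈ s | Q p ∧ f p = x} = #{p ∈ s | Q p} := by
  rw [card_eq_sum_card_fiberwise (s := {p ∈ s | Q p}) (f := f) (t := univ) (by simp)]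
  simp only [filter_filter]

theorem sum_div_add_one_le {B S : ℕ} (hB : 0 < B) (f : Fin B → ℕ) (h : ∑ x, f x ≤ B * S) :
    ∑ x, (f x / B + 1) ≤ S + B := by
  rw [sum_add_distrib]
  simp only [sum_const, card_univ, Fintype.card_fin, smul_eq_mul, mul_one]
  have : B * ∑ x, f x / B ≤ B * S := by
    rw [mul_sum]
    exact (sum_le_sum fun x _ => Nat.mul_div_le (f x) B).trans h
  have := Nat.le_of_mul_le_mul_left this hB
  omega

/-- The nodes form a square grid. What the nodes of a row know individually is shared within
the row, if it amounts to one number per node. -/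
theorem Reach.shareRow {Ω : Type} {B W : ℕ} {K : Knowledge (Fin B × Fin B) Ω}
    (f : Ω → Fin B → Fin B → Fin B → ℕ) (hf : ∀ ω a b c, f ω a b c < W)
    (hK : ∀ a b ω ω', K (a, b) ω ω' → ∀ c, f ω a b c = f ω' a b c) :
    Reach W 2 K (fun v ω ω' => K v ω ω' ∧ f ω v.1 = f ω' v.1) := by
  refine Reach.trans (Reach.word (fun u v ω => if v.1 = u.2 then f ω u.1 u.2 v.2 else 0) ?_ ?_)
    ((Reach.word (fun u v ω => f ω v.1 u.1 u.2) ?_ ?_).mono_right ?_) (r := 1) (s := 1)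
  · intro u v ω
    have := hf ω u.1 u.2 v.2
    split_ifs <;> omega
  · rintro ⟨a, b⟩ v ω ω' h
    simp only [hK a b ω ω' h]
  · exact fun u v ω => hf _ _ _ _
  · rintro u v ω ω' ⟨_, h⟩
    have := h (v.1, u.1)
    simpa using this
  · rintro v ω ω' ⟨⟨h, _⟩, h'⟩
    exact ⟨h, funext fun b => funext fun c => h' (b, c)⟩

/-- Routing on a square grid of nodes: if every node is the source and the destination of at
most `S` packets, then all packets can be delivered. -/
theorem Reach.routeGrid {Ω P : Type} [Fintype P] {B W S : ℕ} (hB : 0 < B)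
    {K : Knowledge (Fin B × Fin B) Ω} (A : Ω → Finset P) (src dst : P → Fin B × Fin B)
    (hW : Fintype.card (P × (Fin B × Fin B)) < W)
    (hheld : ∀ v ω ω', K v ω ω' → held A (fun _ => src) v ω = held A (fun _ => src) v ω')
    (hS : ∀ ω v, #{p ∈ A ω | src p = v} ≤ S) (hS' : ∀ ω v, #{p ∈ A ω | dst p = v} ≤ S) :
    Reach W (7 + 3 * (2 * (2 * (S + B) / (B * B) + 1))) K (fun v ω ω' => K v ω ω' ∧
      held A (fun _ => dst) v ω = held A (fun _ => dst) v ω') := by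
  classical
  have : Nonempty (Fin B × Fin B) := ⟨(⟨0, hB⟩, ⟨0, hB⟩)⟩
  have hP : ∀ s : Finset P, #s < W := by
    intro s
    refine (card_le_univ s).trans_lt (lt_of_le_of_lt ?_ hW)
    exact Fintype.card_le_of_injective (fun p => (p, (⟨0, hB⟩, ⟨0, hB⟩)))
      fun p p' h => (Prod.mk.inj h).1
  have hcardV : Fintype.card (Fin B × Fin B) = B * B := by simp
  let str : Ω → Fin B → Fin B → Fin B → Finset P := fun ω a c b =>
    {p ∈ A ω | src p = (a, b) ∧ (dst p).1 = c}
  let pos : Ω → P → ℕ := fun ω p => position (str ω (src p).1 (dst p).1) (src p).2 p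
  let c₁ : Ω → P → Fin B := fun ω p => ⟨pos ω p % B, Nat.mod_lt _ hB⟩
  let N : Ω → Fin B → Fin B → ℕ := fun ω a c => #{p ∈ A ω | (src p).1 = a ∧ (dst p).1 = c}
  have hN : ∀ ω a c, ∑ b, #(str ω a c b) = N ω a c := by
    intro ω a c
    simp only [N]
    rw [← sum_card_filter_and_eq (A ω) _ (fun p => (src p).2)]
    refine sum_congr rfl fun b _ => congrArg card (filter_congr fun p _ => ?_)
    rw [Prod.ext_iff]
    tauto
  have hNrow : ∀ ω a, ∑ c, N ω a c ≤ B * S := by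
    intro ω a
    simp only [N]
    rw [sum_card_filter_and_eq, ← sum_card_filter_and_eq (A ω) _ (fun p => (src p).2)]
    refine (sum_le_sum fun b _ => (le_of_eq (congrArg card (filter_congr fun p _ => ?_))).trans
      (hS ω (a, b))).trans (by simp)
    rw [Prod.ext_iff]
  have hNcol : ∀ ω c, ∑ a, N ω a c ≤ B * S := by
    intro ω c
    have : ∀ a, N ω a c = #{p ∈ A ω | (dst p).1 = c ∧ (src p).1 = a} := fun a =>
      congrArg card (filter_congr fun p _ => and_comm)
    simp only [this]
    rw [sum_card_filter_and_eq, ← sum_card_filter_and_eq (A ω) _ (fun p => (dst p).2)]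
    refine (sum_le_sum fun b _ => (le_of_eq (congrArg card (filter_congr fun p _ => ?_))).trans
      (hS' ω (c, b))).trans (by simp)
    rw [Prod.ext_iff]
  have hplane : ∀ ω b' a c, #{p ∈ A ω | c₁ ω p = b' ∧ (src p).1 = a ∧ (dst p).1 = c} ≤
      N ω a c / B + 1 := by
    intro ω b' a c
    have hmem : ∀ p ∈ ({p ∈ A ω | (src p).1 = a ∧ (dst p).1 = c} : Finset P),
        p ∈ str ω a c (src p).2 ∧ pos ω p = position (str ω a c) (src p).2 p := by
      intro p hp
      obtain ⟨hA, rfl, rfl⟩ := mem_filter.mp hp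
      exact ⟨by simpa [str] using hA, rfl⟩
    refine le_trans (card_le_card ?_) (card_filter_mod_le
      ({p ∈ A ω | (src p).1 = a ∧ (dst p).1 = c} : Finset P) (pos ω) B b' (L := N ω a c) ?_ ?_)
    · intro p
      simp only [mem_filter, c₁, Fin.ext_iff]
      tauto
    · intro p hp p' hp' h
      obtain ⟨h1, h2⟩ := hmem p hp
      obtain ⟨h3, h4⟩ := hmem p' hp'
      rw [h2, h4] at h
      exact (position_inj h1 h3 h).2
    · intro p hp
      obtain ⟨h1, h2⟩ := hmem p hp
      rw [h2, ← hN]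
      exact position_lt h1
  -- the sizes of the streams are shared within the rows
  refine Reach.mono_rounds (Nat.zero_lt_of_lt (hP ∅)) (Reach.trans (r := 2)
    (Reach.shareRow (fun ω a b c => #(str ω a c b)) (fun _ _ _ _ => hP _) ?_) ?_) (le_of_eq ?_)
    (r := 2 + (2 + (2 * (2 * (S + B) / (B * B) + 1) + (1 + (2 * (2 * (S + B) / (B * B) + 1) +
      (2 + 2 * (2 * (S + B) / (B * B) + 1)))))))
  · intro a b ω ω' h c
    have h' := hheld _ _ _ h
    have : ∀ ω, str ω a c b = {p ∈ held A (fun _ => src) (a, b) ω | (dst p).1 = c} := by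
      intro ω; simp [str, held, filter_filter]
    simp only [this, h']
  · set K₁ : Knowledge (Fin B × Fin B) Ω := fun v ω ω' => K v ω ω' ∧
      (fun b c => #(str ω v.1 c b)) = (fun b c => #(str ω' v.1 c b)) with hK₁
    have hc₁ : ∀ v ω ω', K₁ v ω ω' → ∀ p ∈ held A (fun _ => src) v ω, c₁ ω p = c₁ ω' p := by
      rintro v ω ω' ⟨h, h'⟩ p hp
      obtain ⟨hp, rfl⟩ := mem_held.mp hp
      have h1 : str ω (src p).1 (dst p).1 (src p).2 = str ω' (src p).1 (dst p).1 (src p).2 := by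
        have : ∀ ω, str ω (src p).1 (dst p).1 (src p).2 =
            {p' ∈ held A (fun _ => src) (src p) ω | (dst p').1 = (dst p).1} := by
          intro ω; simp [str, held, filter_filter]
        simp only [this, hheld _ _ _ h]
      have h2 : ∀ b, #(str ω (src p).1 (dst p).1 b) = #(str ω' (src p).1 (dst p).1 b) :=
        fun b => congrFun (congrFun h' b) (dst p).1
      simp only [c₁, pos, position, h1, h2]
    let M₁ : Ω → Fin B → Fin B → Fin B → ℕ := fun ω a b b' =>
      #{p ∈ held A (fun _ => src) (a, b) ω | c₁ ω p = b'}
    refine Reach.trans (r := 2) (Reach.shareRow M₁ (fun _ _ _ _ => hP _) ?_) ?_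
    · intro a b ω ω' h b'
      simp only [M₁]
      rw [← hheld _ _ _ h.1]
      exact congrArg card (filter_congr fun p hp => by rw [hc₁ _ _ _ h p hp])
    refine Reach.trans (Reach.rows (L := S + B) hcardV A (Equiv.refl _) (fun _ p => (src p).1)
      (fun _ p => (src p).2) c₁ M₁ hW ?_ ?_ ?_ ?_ ?_ ?_) ?_
    · exact fun v ω ω' h => hheld v ω ω' h.1.1
    · exact fun v ω ω' h => hc₁ v ω ω' h.1
    · exact fun a b ω ω' h => h.2
    · intro ω a b b'
      refine card_le_card fun p => ?_
      simp only [mem_filter, mem_held]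
      rintro ⟨h1, rfl, rfl, h2⟩
      exact ⟨⟨h1, rfl⟩, h2⟩
    · intro ω a b
      simp only [M₁, held, filter_filter]
      rw [sum_card_filter_and_eq]
      exact (hS ω _).trans (Nat.le_add_right _ _)
    · intro ω a b'
      refine le_trans (le_of_eq ?_) ((sum_le_sum fun c _ => hplane ω b' a c).trans
        (sum_div_add_one_le hB _ (hNrow ω a)))
      have h1 : ∀ c, #{p ∈ A ω | c₁ ω p = b' ∧ (src p).1 = a ∧ (dst p).1 = c} =
          #{p ∈ A ω | (c₁ ω p = b' ∧ (src p).1 = a) ∧ (dst p).1 = c} := fun c =>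
        congrArg card (filter_congr fun p _ => by tauto)
      simp only [h1]
      rw [sum_card_filter_and_eq, ← sum_card_filter_and_eq (A ω) _ (fun p => (src p).2)]
      refine sum_congr rfl fun b _ => ?_
      simp only [M₁, held, filter_filter]
      refine congrArg card (filter_congr fun p _ => ?_)
      rw [Prod.ext_iff]
      tauto
    -- the sizes of the streams become public
    refine Reach.trans (r := 1) (Reach.word (fun u _ ω => N ω u.1 u.2) (fun _ _ _ => hP _) ?_) ?_
    · rintro u v ω ω' ⟨⟨⟨h, h'⟩, _⟩, _⟩
      rw [← hN, ← hN]
      exact sum_congr rfl fun b _ => congrFun (congrFun h' b) _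
    refine Reach.trans (Reach.rows (L := S + B) hcardV A (Equiv.prodComm _ _) c₁
      (fun _ p => (src p).1) (fun _ p => (dst p).1) (fun ω b' a c => N ω a c / B + 1) hW
      ?_ ?_ ?_ ?_ ?_ ?_) ?_
    · exact fun v ω ω' h => h.1.2
    · exact fun _ _ _ _ _ _ => rfl
    · intro a b ω ω' h
      funext a c
      rw [h.2 (a, c)]
    · exact fun ω b' a c => hplane ω b' a c
    · exact fun ω b' a => sum_div_add_one_le hB _ (hNrow ω a)
    · exact fun ω b' a => sum_div_add_one_le hB _ (hNcol ω a)
    let M₃ : Ω → Fin B → Fin B → Fin B → ℕ := fun ω c b' d =>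
      #{p ∈ held A (fun ω p => ((dst p).1, c₁ ω p)) (c, b') ω | (dst p).2 = d}
    refine Reach.trans (r := 2) (Reach.shareRow M₃ (fun _ _ _ _ => hP _) ?_) ?_
    · intro c b' ω ω' h d
      have : held A (fun ω p => ((dst p).1, c₁ ω p)) (c, b') ω =
        held A (fun ω p => ((dst p).1, c₁ ω p)) (c, b') ω' := h.2
      simp only [M₃, this]
    refine (Reach.rows (L := S + B) hcardV A (Equiv.refl _) (fun _ p => (dst p).1)
      c₁ (fun _ p => (dst p).2) M₃ hW ?_ ?_ ?_ ?_ ?_ ?_ : Reach W _ _ _).mono_right ?_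
    · exact fun v ω ω' h => h.1.2
    · exact fun _ _ _ _ _ _ => rfl
    · exact fun a b ω ω' h => h.2
    · intro ω c b' d
      refine card_le_card fun p => ?_
      simp only [mem_filter, mem_held]
      rintro ⟨h1, rfl, rfl, h2⟩
      exact ⟨⟨h1, rfl⟩, h2⟩
    · intro ω c b'
      refine le_trans (le_of_eq ?_) ((sum_le_sum fun a _ => hplane ω b' a c).trans
        (sum_div_add_one_le hB _ (hNcol ω c)))
      have h1 : ∀ a, #{p ∈ A ω | c₁ ω p = b' ∧ (src p).1 = a ∧ (dst p).1 = c} =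
          #{p ∈ A ω | (c₁ ω p = b' ∧ (dst p).1 = c) ∧ (src p).1 = a} := fun c =>
        congrArg card (filter_congr fun p _ => by tauto)
      simp only [h1]
      rw [sum_card_filter_and_eq, ← sum_card_filter_and_eq (A ω) _ (fun p => (dst p).2)]
      refine sum_congr rfl fun b _ => ?_
      simp only [M₃, held, filter_filter]
      refine congrArg card (filter_congr fun p _ => ?_)
      rw [Prod.ext_iff]
      tauto
    · intro ω c d
      refine le_trans (le_of_eq ?_) ((hS' ω (c, d)).trans (Nat.le_add_right _ _))
      rw [← sum_card_filter_and_eq (A ω) _ (c₁ ω)]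
      refine sum_congr rfl fun b _ => ?_
      simp only [M₃, held, filter_filter]
      refine congrArg card (filter_congr fun p _ => ?_)
      simp only [Prod.ext_iff]
      tauto
    · exact fun v ω ω' h => ⟨h.1.1.1.1.1.1.1, h.2⟩
  · ring

/-- Routing: if every node is the source and the destination of at most `S` packets, then all
packets can be delivered in `O(S / n + 1)` rounds. -/
theorem Reach.route {Ω P : Type} [Fintype P] {n W S : ℕ} (hn : 0 < n)
    {K : Knowledge (Fin n) Ω} (A : Ω → Finset P) (src dst : P → Fin n)
    (hW : Fintype.card P * (4 * n) < W)
    (hheld : ∀ v ω ω', K v ω ω' → held A (fun _ => src) v ω = held A (fun _ => src) v ω')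
    (hS : ∀ ω v, #{p ∈ A ω | src p = v} ≤ S) (hS' : ∀ ω v, #{p ∈ A ω | dst p = v} ≤ S) :
    Reach W (496 * (S / n + 1)) K (fun v ω ω' => K v ω ω' ∧
      held A (fun _ => dst) v ω = held A (fun _ => dst) v ω') := by
  classical
  obtain ⟨B, hB, hnB, hBn⟩ : ∃ B, 0 < B ∧ n ≤ B * B ∧ B * B ≤ 4 * n := by
    refine ⟨Nat.sqrt (n - 1) + 1, Nat.succ_pos _, ?_, ?_⟩
    · have := Nat.lt_succ_sqrt (n - 1)
      simp only [Nat.succ_eq_add_one] at this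
      omega
    · have h1 := Nat.sqrt_le (n - 1)
      have h2 := Nat.sqrt_le_self (n - 1)
      nlinarith [Nat.sub_add_cancel hn]
  let host : Fin B × Fin B → Fin n := fun x => ⟨finProdFinEquiv x % n, Nat.mod_lt _ hn⟩
  let label : Fin B × Fin B → Fin 4 := fun x => ⟨finProdFinEquiv x / n, by
    rw [Nat.div_lt_iff_lt_mul hn]
    exact (Fin.is_lt _).trans_le hBn⟩
  let ι : Fin n → Fin B × Fin B := fun x => finProdFinEquiv.symm ⟨x, x.2.trans_le hnB⟩
  have hι : ∀ x, host (ι x) = x := by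
    intro x
    simp only [host, ι, Equiv.apply_symm_apply, Nat.mod_eq_of_lt x.2]
  have hιinj : Function.Injective ι := Function.LeftInverse.injective hι
  have hsub : ∀ (f : P → Fin n), (∀ ω v, #{p ∈ A ω | f p = v} ≤ S) →
      ∀ ω v, #{p ∈ A ω | ι (f p) = v} ≤ S := by
    intro f hf ω v
    refine (card_le_card fun p => ?_).trans (hf ω (host v))
    simp only [mem_filter]
    rintro ⟨h, rfl⟩
    exact ⟨h, (hι _).symm⟩
  have hheldι : ∀ (f : P → Fin n) x ω,
      held A (fun _ p => ι (f p)) (ι x) ω = held A (fun _ => f) x ω := by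
    intro f x ω
    ext p
    simp [mem_held, hιinj.eq_iff]
  have hW' : Fintype.card (P × (Fin B × Fin B)) < W := by
    refine lt_of_le_of_lt ?_ hW
    simp only [Fintype.card_prod, Fintype.card_fin]
    exact Nat.mul_le_mul_left _ hBn
  have h := Reach.simulate (V := Fin n) (Nat.zero_lt_of_lt hW) host label ?_
    (Reach.routeGrid (S := S) (K := fun v ω ω' => K (host v) ω ω') hB A (fun p => ι (src p))
      (fun p => ι (dst p)) hW' ?_ (hsub src hS) (hsub dst hS'))
  · refine Reach.mono_rounds (Nat.zero_lt_of_lt hW) ((h.mono_left ?_).mono_right ?_) ?_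
    · rintro v ω ω' h x rfl
      exact h
    · intro v ω ω' h
      have h1 := h (ι v) (hι v)
      rw [hι, hheldι, hheldι] at h1
      exact h1
    · have h1 : 2 * (S + B) / (B * B) ≤ 2 * (S / n) + 3 := by
        calc 2 * (S + B) / (B * B) ≤ (2 * S + 2 * (B * B)) / (B * B) :=
              Nat.div_le_div_right (by nlinarith)
          _ = 2 * S / (B * B) + 2 := Nat.add_mul_div_right _ _ (Nat.mul_pos hB hB)
          _ ≤ 2 * S / n + 2 := Nat.add_le_add_right (Nat.div_le_div_left hnB hn) 2
          _ ≤ 2 * (S / n) + 3 := by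
            have : 2 * S / n ≤ 2 * (S / n) + 1 := by
              rw [← Nat.lt_succ_iff, Nat.div_lt_iff_lt_mul hn]
              have h1 := Nat.div_add_mod S n
              have h2 := Nat.mod_lt S hn
              simp only [Nat.succ_eq_add_one]
              nlinarith
            omega
      omega
  · intro x y h1 h2
    simp only [host, label, Fin.mk.injEq] at h1 h2
    apply finProdFinEquiv.injective
    rw [Fin.ext_iff, ← Nat.div_add_mod (finProdFinEquiv x : ℕ) n, h1, h2, Nat.div_add_mod]
  · intro v ω ω' h
    have h1 := hheld _ _ _ h
    have : ∀ ω, held A (fun _ p => ι (src p)) v ω =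
        {p ∈ held A (fun _ => src) (host v) ω | ι (src p) = v} := by
      intro ω
      ext p
      simp only [mem_held, mem_filter]
      refine ⟨?_, fun h => ⟨h.1.1, h.2⟩⟩
      rintro ⟨hp, rfl⟩
      exact ⟨⟨hp, (hι _).symm⟩, rfl⟩
    simp only [this, h1]

/-- A weighted set of nodes is cut into `q` intervals of about the same weight. -/
theorem exists_interval_partition {n q : ℕ} (hq : 0 < q) (y : Fin n → ℝ) (Y : ℝ) (hY : 0 < Y)
    (h0 : ∀ v, 0 ≤ y v) (h1 : ∀ v, y v ≤ Y) (hs : ∑ v, y v ≤ q * Y) :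
    ∃ g : Fin n → ℕ, Monotone g ∧ (∀ v, g v < q) ∧ ∀ b, ∑ v with g v = b, y v ≤ 2 * Y := by
  let pre : Fin n → ℝ := fun v => ∑ u ∈ Iio v, y u
  have hpre : Monotone pre := by
    intro v w h
    refine sum_le_sum_of_subset_of_nonneg (fun u hu => ?_) fun u _ _ => h0 u
    exact mem_Iio.mpr ((mem_Iio.mp hu).trans_le h)
  have hpre0 : ∀ v, 0 ≤ pre v := fun v => sum_nonneg fun u _ => h0 u
  have hpre1 : ∀ v, pre v + y v = ∑ u ∈ Iic v, y u := by
    intro v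
    rw [← Iio_insert, sum_insert (by simp), add_comm]
  refine ⟨fun v => min ⌊pre v / Y⌋₊ (q - 1), ?_, ?_, ?_⟩
  · intro v w h
    exact min_le_min_right _ (Nat.floor_mono (by gcongr; exact hpre h))
  · intro v
    exact (min_le_right _ _).trans_lt (Nat.sub_lt hq one_pos)
  · intro b
    rcases (univ.filter fun v => min ⌊pre v / Y⌋₊ (q - 1) = b).eq_empty_or_nonempty with he | he
    · rw [he, sum_empty]; positivity
    · set F := univ.filter fun v => min ⌊pre v / Y⌋₊ (q - 1) = b
      have hmin := (mem_filter.mp (F.min'_mem he)).2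
      have hmax := (mem_filter.mp (F.max'_mem he)).2
      have hsum : ∑ v ∈ F, y v ≤ pre (F.max' he) + y (F.max' he) - pre (F.min' he) := by
        rw [hpre1, le_sub_iff_add_le]
        simp only [pre]
        rw [← sum_union]
        · refine sum_le_sum_of_subset_of_nonneg (fun u hu => ?_) fun u _ _ => h0 u
          rw [mem_Iic]
          rcases mem_union.mp hu with hu | hu
          · exact F.le_max' u hu
          · exact (mem_Iio.mp hu).le.trans (F.le_max' _ (F.min'_mem he))
        · rw [disjoint_left]
          intro u hu hu'
          exact absurd (F.min'_le u hu) (not_le.mpr (mem_Iio.mp hu'))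
      have hlow : (b : ℝ) * Y ≤ pre (F.min' he) := by
        rw [← le_div_iff₀ hY]
        refine le_trans ?_ (Nat.floor_le (div_nonneg (hpre0 _) hY.le))
        exact_mod_cast hmin ▸ min_le_left _ _
      by_cases hb : b < q - 1
      · have h3 : ⌊pre (F.max' he) / Y⌋₊ < b + 1 := by omega
        rw [Nat.floor_lt (div_nonneg (hpre0 _) hY.le), div_lt_iff₀ hY] at h3
        push_cast at h3
        linarith [h1 (F.max' he)]
      · have h4 : pre (F.max' he) + y (F.max' he) ≤ q * Y := by
          rw [hpre1]
          exact (sum_le_sum_of_subset_of_nonneg (subset_univ _) fun u _ _ => h0 u).trans hs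
        have h5 : (q : ℝ) ≤ b + 1 := by
          have : q ≤ b + 1 := by omega
          exact_mod_cast this
        nlinarith

/-- The same for several weights at once. -/
theorem exists_interval_partition_family {n q l : ℕ} (hq : 0 < q) (hl : 0 < l)
    (x : Fin l → Fin n → ℝ) (X : Fin l → ℝ) (h0 : ∀ a v, 0 ≤ x a v) (h1 : ∀ a v, x a v ≤ X a)
    (hs : ∀ a, ∑ v, x a v ≤ q * X a) :
    ∃ g : Fin n → ℕ, Monotone g ∧ (∀ v, g v < q) ∧
      ∀ a b, ∑ v with g v = b, x a v ≤ 2 * l * X a := by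
  have hX : ∀ a, 0 ≤ X a := by
    intro a
    rcases isEmpty_or_nonempty (Fin n) with hn | ⟨⟨v⟩⟩
    · have := hs a
      simp only [univ_eq_empty, sum_empty] at this
      exact nonneg_of_mul_nonneg_right this (by exact_mod_cast hq)
    · exact (h0 a v).trans (h1 a v)
  have hy1 : ∀ v, ∑ a, x a v / X a ≤ l := fun v =>
    (sum_le_sum fun a _ => div_le_one_of_le₀ (h1 a v) (hX a)).trans (by simp)
  have hys : ∑ v, ∑ a, x a v / X a ≤ q * l := by
    rw [sum_comm]
    refine (sum_le_sum fun a _ => ?_).trans (b := ∑ _a : Fin l, (q : ℝ)) (by simp [mul_comm])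
    rw [← sum_div]
    rcases (hX a).eq_or_lt with h | h
    · simp [← h]
    · exact (div_le_iff₀ h).mpr (hs a)
  obtain ⟨g, hg, hgq, hgs⟩ := exists_interval_partition hq (fun v => ∑ a, x a v / X a) l
    (by exact_mod_cast hl) (fun v => sum_nonneg fun a _ => div_nonneg (h0 a v) (hX a)) hy1 hys
  refine ⟨g, hg, hgq, fun a b => ?_⟩
  have h2 : (∑ v with g v = b, x a v) / X a ≤ 2 * l := by
    refine le_trans ?_ (hgs b)
    rw [sum_div]
    refine sum_le_sum fun v _ => ?_
    exact single_le_sum (f := fun a => x a v / X a) (fun a _ => div_nonneg (h0 a v) (hX a))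
      (mem_univ a)
  rcases (hX a).eq_or_lt with h | h
  · rw [← h, mul_zero]
    exact sum_nonpos fun v _ => (h1 a v).trans h.symm.le
  · exact (div_le_iff₀ h).mp h2

open Classical in
/-- A division of the nodes into `q` intervals of about the same weights. -/
noncomputable def intervalPartition {n : ℕ} (q : ℕ) (x : Fin 3 → Fin n → ℝ) (X : Fin 3 → ℝ) :
    Fin n → ℕ :=
  if h : ∃ g : Fin n → ℕ, Monotone g ∧ (∀ v, g v < q) ∧
      ∀ a b, ∑ v with g v = b, x a v ≤ 6 * X a then h.choose else 0

theorem intervalPartition_monotone {n : ℕ} (q : ℕ) (x : Fin 3 → Fin n → ℝ) (X : Fin 3 → ℝ) :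
    Monotone (intervalPartition q x X) := by
  unfold intervalPartition
  split_ifs with h
  · exact h.choose_spec.1
  · exact monotone_const

theorem intervalPartition_lt {n q : ℕ} (hq : 0 < q) (x : Fin 3 → Fin n → ℝ) (X : Fin 3 → ℝ)
    (v : Fin n) : intervalPartition q x X v < q := by
  unfold intervalPartition
  split_ifs with h
  · exact h.choose_spec.2.1 v
  · exact hq

theorem sum_intervalPartition_le {n q : ℕ} (hq : 0 < q) {x : Fin 3 → Fin n → ℝ} {X : Fin 3 → ℝ}
    (h0 : ∀ a v, 0 ≤ x a v) (h1 : ∀ a v, x a v ≤ X a) (hs : ∀ a, ∑ v, x a v ≤ q * X a)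
    (a : Fin 3) (b : ℕ) : ∑ v with intervalPartition q x X v = b, x a v ≤ 6 * X a := by
  have h : ∃ g : Fin n → ℕ, Monotone g ∧ (∀ v, g v < q) ∧
      ∀ a b, ∑ v with g v = b, x a v ≤ 6 * X a := by
    obtain ⟨g, h1, h2, h3⟩ := exists_interval_partition_family hq (by norm_num) x X h0 h1 hs
    refine ⟨g, h1, h2, fun a b => (h3 a b).trans (le_of_eq ?_)⟩
    norm_num
  simp only [intervalPartition, dif_pos h]
  exact h.choose_spec.2.2 a b

section Tree

variable {n : ℕ}

open Classical in
/-- The neighbours of `v` in `G`. -/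
noncomputable def nbr (G : SimpleGraph (Fin n)) (v : Fin n) : Finset (Fin n) :=
  {u | G.Adj v u}

theorem mem_nbr {G : SimpleGraph (Fin n)} {v u : Fin n} : u ∈ nbr G v ↔ G.Adj v u := by
  simp [nbr]

variable (R : ℕ → ℕ → Prop) (q M : ℕ)

open Classical in
/-- The number of pattern vertices before `i` that are adjacent to `i`. -/
noncomputable def backDegree (i : ℕ) : ℕ := #{j ∈ range i | R j i}

/-- The part of the nodes to which the leaf (or prefix) `t` assigns the pattern vertex `j`. Leaves
are numbers whose base `q` digits select a part on every level. -/
def part (q : ℕ) (T : ℕ → ℕ → Fin n → ℕ) (j t : ℕ) : Finset (Fin n) :=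
  {u | T j (t % q ^ j) u = t / q ^ j % q}

open Classical in
/-- The number of edges from `v` to the parts that the prefix `s` of length `i` selects for the
pattern vertices adjacent to `i`. -/
noncomputable def crossDegree (G : SimpleGraph (Fin n)) (T : ℕ → ℕ → Fin n → ℕ) (i s : ℕ)
    (v : Fin n) : ℕ :=
  ∑ j ∈ range i with R j i, #(nbr G v ∩ part q T j s)

/-- The weights that the partition at a prefix of length `i` has to balance. -/
noncomputable def levelWeight (G : SimpleGraph (Fin n)) (T : ℕ → ℕ → Fin n → ℕ) (i s : ℕ) :
    Fin 3 → Fin n → ℝ :=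
  ![fun _ => 1, fun v => #(nbr G v), fun v => crossDegree R q G T i s v]

/-- The average of these weights, over the parts. -/
noncomputable def levelTarget (n : ℕ) (i : ℕ) : Fin 3 → ℝ :=
  ![(n : ℝ) / q, 2 * M / q, 12 * backDegree R i * M / q ^ 2]

/-- The partition tree: `tree i s` is the partition at the prefix `s` of length `i`. -/
noncomputable def tree (G : SimpleGraph (Fin n)) (i s : ℕ) : Fin n → ℕ :=
  intervalPartition q (levelWeight R q G (fun j s' u => if j < i then tree G j s' u else 0) i s)
    (levelTarget R q M n i)
termination_by i

variable {R q M}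

theorem crossDegree_congr {G G' : SimpleGraph (Fin n)} {T T' : ℕ → ℕ → Fin n → ℕ} {i s : ℕ}
    {v : Fin n} (hq : 0 < q) (hT : ∀ j < i, ∀ s < q ^ j, T j s = T' j s)
    (hG : nbr G v = nbr G' v) : crossDegree R q G T i s v = crossDegree R q G' T' i s v := by
  classical
  refine sum_congr rfl fun j hj => ?_
  have := hT j (mem_range.mp (mem_filter.mp hj).1) (s % q ^ j) (Nat.mod_lt _ (by positivity))
  simp only [part, this, hG]

theorem tree_eq (hq : 0 < q) (G : SimpleGraph (Fin n)) (i s : ℕ) :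
    tree R q M G i s = intervalPartition q (levelWeight R q G (tree R q M G) i s)
      (levelTarget R q M n i) := by
  have h : ∀ v, crossDegree R q G (fun j s' u => if j < i then tree R q M G j s' u else 0) i s v =
      crossDegree R q G (tree R q M G) i s v := fun v =>
    crossDegree_congr hq (fun j hj s _ => by simp [hj]) rfl
  rw [tree]
  simp only [levelWeight, h]

theorem mod_pow_mod_pow {q i j : ℕ} (h : j < i) (t : ℕ) : t % q ^ i % q ^ j = t % q ^ j :=
  Nat.mod_mod_of_dvd _ (pow_dvd_pow _ h.le)

theorem mod_pow_div_pow {q i j : ℕ} (h : j < i) (t : ℕ) :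
    t % q ^ i / q ^ j % q = t / q ^ j % q := by
  obtain ⟨d, rfl⟩ := Nat.exists_eq_add_of_lt h
  rw [show q ^ (j + d + 1) = q ^ j * q ^ (d + 1) by ring, Nat.mod_mul_right_div_self,
    Nat.mod_mod_of_dvd _ (dvd_pow_self q (Nat.succ_ne_zero d))]

theorem crossDegree_mod (G : SimpleGraph (Fin n)) (T : ℕ → ℕ → Fin n → ℕ) (i t : ℕ) (v : Fin n) :
    crossDegree R q G T i (t % q ^ i) v = crossDegree R q G T i t v := by
  classical
  refine sum_congr rfl fun j hj => ?_
  have := mem_range.mp (mem_filter.mp hj).1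
  simp only [part, mod_pow_mod_pow this, mod_pow_div_pow this]

theorem crossDegree_le (G : SimpleGraph (Fin n)) (T : ℕ → ℕ → Fin n → ℕ) (i s : ℕ) (v : Fin n) :
    crossDegree R q G T i s v ≤ i * n := by
  classical
  refine (sum_le_card_nsmul _ _ n fun j _ => (card_le_univ _).trans (by simp)).trans ?_
  rw [smul_eq_mul]
  exact Nat.mul_le_mul_right _ ((card_filter_le _ _).trans (by simp))

theorem sum_card_nbr_inter (G : SimpleGraph (Fin n)) (U : Finset (Fin n)) :
    ∑ v, #(nbr G v ∩ U) = ∑ u ∈ U, #(nbr G u) := by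
  classical
  have h1 : ∀ v, #(nbr G v ∩ U) = ∑ u ∈ U, if G.Adj v u then 1 else 0 := by
    intro v
    rw [← card_filter]
    congr 1
    ext u
    simp [mem_nbr, and_comm]
  have h2 : ∀ u, #(nbr G u) = ∑ v, if G.Adj v u then 1 else 0 := by
    intro u
    rw [← card_filter]
    congr 1
    ext v
    simp [mem_nbr, G.adj_comm]
  simp only [h1, h2]
  rw [sum_comm]

/-- The parts of the partition tree have about the average size, the average sum of degrees and the
average number of edges to the parts selected before. -/
theorem tree_balanced (hq : 0 < q) (hqn : q ≤ n) (G : SimpleGraph (Fin n))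
    (hM : ∑ v, #(nbr G v) ≤ 2 * M) (hM' : n * q ≤ M) (i t : ℕ) :
    (#(part q (tree R q M G) i t) : ℝ) ≤ 6 * (n / q) ∧
    (∑ v ∈ part q (tree R q M G) i t, (#(nbr G v) : ℝ)) ≤ 6 * (2 * M / q) ∧
    (∑ v ∈ part q (tree R q M G) i t, (crossDegree R q G (tree R q M G) i t v : ℝ)) ≤
      6 * (12 * backDegree R i * M / q ^ 2) := by
  classical
  induction i using Nat.strong_induction_on generalizing t with
  | _ i ih =>
    set T := tree R q M G
    have hq' : (0 : ℝ) < q := by exact_mod_cast hq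
    have hMr : (n : ℝ) * q ≤ M := by exact_mod_cast hM'
    have hcross : ∀ (s : ℕ) (v : Fin n), (crossDegree R q G T i s v : ℝ) ≤
        12 * backDegree R i * M / q ^ 2 := by
      intro s v
      have h1 : (crossDegree R q G T i s v : ℝ) ≤ backDegree R i * (6 * (n / q)) := by
        rw [crossDegree, backDegree, ← nsmul_eq_mul]
        push_cast
        refine sum_le_card_nsmul _ _ _ fun j hj => ?_
        refine le_trans ?_ (ih j (mem_range.mp (mem_filter.mp hj).1) s).1
        exact_mod_cast card_le_card inter_subset_right
      refine h1.trans ?_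
      rw [le_div_iff₀ (by positivity)]
      have : (backDegree R i : ℝ) * (6 * (n / q)) * q ^ 2 = 6 * backDegree R i * (n * q) := by
        field_simp
      rw [this]
      have : (0 : ℝ) ≤ backDegree R i := by positivity
      have hM0 : (0 : ℝ) ≤ M := by positivity
      nlinarith [mul_le_mul_of_nonneg_left hMr this, mul_nonneg this hM0]
    have hcrossSum : ∀ s, (∑ v, (crossDegree R q G T i s v : ℝ)) ≤
        q * (12 * backDegree R i * M / q ^ 2) := by
      intro s
      have h1 : (∑ v, (crossDegree R q G T i s v : ℝ)) =
          ∑ j ∈ range i with R j i, ∑ u ∈ part q T j s, (#(nbr G u) : ℝ) := by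
        simp only [crossDegree]
        push_cast
        rw [sum_comm]
        refine sum_congr rfl fun j _ => ?_
        exact_mod_cast sum_card_nbr_inter G _
      rw [h1]
      refine (sum_le_card_nsmul _ _ _ fun j hj =>
        (ih j (mem_range.mp (mem_filter.mp hj).1) s).2.1).trans (le_of_eq ?_)
      rw [nsmul_eq_mul, ← backDegree]
      field_simp
      ring
    have key := fun b => sum_intervalPartition_le (n := n) (q := q) hq
      (x := levelWeight R q G T i (t % q ^ i)) (X := levelTarget R q M n i) ?_ ?_ ?_
      (b := t / q ^ i % q) (a := b)
    · rw [← tree_eq hq] at key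
      have h0 := key 0
      have h1 := key 1
      have h2 := key 2
      simp only [levelWeight, levelTarget, crossDegree_mod, Matrix.cons_val_zero,
        Matrix.cons_val_one, Matrix.cons_val, sum_const, nsmul_eq_mul, mul_one] at h0 h1 h2
      exact ⟨h0, h1, h2⟩
    · intro a v
      fin_cases a <;> simp [levelWeight]
    · intro a v
      fin_cases a
      · simp only [levelWeight, levelTarget, Fin.zero_eta, Matrix.cons_val_zero]
        rw [le_div_iff₀ hq', one_mul]
        exact_mod_cast hqn
      · simp only [levelWeight, levelTarget, Fin.mk_one, Matrix.cons_val_one, Matrix.cons_val_zero]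
        rw [le_div_iff₀ hq']
        have : (#(nbr G v) : ℝ) ≤ n := by
          exact_mod_cast (card_le_univ (nbr G v)).trans (by simp)
        nlinarith
      · simpa [levelWeight, levelTarget] using hcross _ v
    · intro a
      fin_cases a
      · simp only [levelWeight, levelTarget, Fin.zero_eta, Matrix.cons_val_zero]
        simp only [sum_const, card_univ, Fintype.card_fin, nsmul_eq_mul, mul_one]
        exact le_of_eq (by field_simp)
      · simp only [levelWeight, levelTarget, Fin.mk_one, Matrix.cons_val_one, Matrix.cons_val_zero]
        rw [mul_div_cancel₀ _ hq'.ne']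
        exact_mod_cast hM
      · simpa [levelWeight, levelTarget] using hcrossSum _

end Tree

theorem div_pow_lt {q r t : ℕ} (ht : t < q ^ (r + 1)) : t / q ^ r < q :=
  Nat.div_lt_of_lt_mul (by rwa [← pow_succ])

/-- The numbers with `r` digits, some of which are prescribed as functions of the lower ones. -/
theorem card_prescribed_digits {q : ℕ} (hq : 0 < q) (g : ℕ → ℕ → ℕ) (I : Finset ℕ) (r : ℕ) :
    #{t ∈ range (q ^ r) | ∀ i ∈ I, i < r → g i (t % q ^ i) = t / q ^ i % q} *
      q ^ #{i ∈ I | i < r} ≤ q ^ r := by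
  induction r with
  | zero => simp
  | succ r ih =>
    have hlow : ∀ t, (∀ i ∈ I, i < r + 1 → g i (t % q ^ i) = t / q ^ i % q) →
        ∀ i ∈ I, i < r → g i (t % q ^ r % q ^ i) = t % q ^ r / q ^ i % q := by
      intro t h i hi hir
      rw [mod_pow_mod_pow hir, mod_pow_div_pow hir]
      exact h i hi (hir.trans (Nat.lt_succ_self r))
    set F := ({t ∈ range (q ^ r) | ∀ i ∈ I, i < r → g i (t % q ^ i) = t / q ^ i % q} : Finset ℕ)
    by_cases hr : r ∈ I
    · have h1 : ({i ∈ I | i < r + 1} : Finset ℕ) = insert r {i ∈ I | i < r} := by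
        ext i
        simp only [mem_filter, mem_insert, Nat.lt_succ_iff_lt_or_eq]
        constructor
        · rintro ⟨h, h' | h'⟩
          · exact .inr ⟨h, h'⟩
          · exact .inl h'
        · rintro (rfl | h)
          · exact ⟨hr, .inr rfl⟩
          · exact ⟨h.1, .inl h.2⟩
      rw [h1, card_insert_of_notMem (by simp), pow_succ q #_, ← mul_assoc, pow_succ q r]
      refine Nat.mul_le_mul_right _ (le_trans (Nat.mul_le_mul_right _ ?_) ih)
      refine card_le_card_of_injOn (fun t => t % q ^ r) (fun t ht => ?_) fun t ht t' ht' h => ?_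
      · simp only [coe_filter, Set.mem_ofPred_eq, F, mem_range] at ht ⊢
        exact ⟨Nat.mod_lt _ (by positivity), hlow t ht.2⟩
      · simp only [coe_filter, Set.mem_ofPred_eq, mem_range] at ht ht' h
        have h2 := ht.2 r hr (Nat.lt_succ_self r)
        have h3 := ht'.2 r hr (Nat.lt_succ_self r)
        rw [h, h3, Nat.mod_eq_of_lt (div_pow_lt ht.1), Nat.mod_eq_of_lt (div_pow_lt ht'.1)] at h2
        rw [← Nat.div_add_mod t (q ^ r), ← Nat.div_add_mod t' (q ^ r), h, h2]
    · have h1 : ({i ∈ I | i < r + 1} : Finset ℕ) = {i ∈ I | i < r} := by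
        refine filter_congr fun i hi => ?_
        have : i ≠ r := fun h => hr (h ▸ hi)
        omega
      rw [h1, pow_succ]
      refine le_trans ?_ (Nat.mul_le_mul_right q ih)
      rw [Nat.mul_right_comm]
      refine Nat.mul_le_mul_right _ ?_
      calc _ ≤ #(F ×ˢ range q) := ?_
        _ = _ := by rw [card_product, card_range]
      refine card_le_card_of_injOn (fun t => (t % q ^ r, t / q ^ r)) (fun t ht => ?_)
        fun t ht t' ht' h => ?_
      · simp only [coe_filter, Set.mem_ofPred_eq, F, mem_range, coe_product, Set.mem_prod,
          coe_range, Set.mem_Iio] at ht ⊢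
        exact ⟨⟨Nat.mod_lt _ (by positivity), hlow t ht.2⟩, div_pow_lt ht.1⟩
      · simp only [Prod.mk.injEq] at h
        rw [← Nat.div_add_mod t (q ^ r), ← Nat.div_add_mod t' (q ^ r), h.1, h.2]

/-- All digits can be prescribed as functions of the lower ones. -/
theorem exists_prescribed_digits {q : ℕ} (hq : 0 < q) (g : ℕ → ℕ → ℕ) (hg : ∀ i s, g i s < q)
    (r : ℕ) : ∃ t < q ^ r, ∀ i < r, g i (t % q ^ i) = t / q ^ i % q := by
  induction r with
  | zero => exact ⟨0, by simp, by simp⟩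
  | succ r ih =>
    obtain ⟨t, ht, h⟩ := ih
    have hpos : 0 < q ^ r := by positivity
    have hmod : (t + q ^ r * g r t) % q ^ r = t := by
      rw [Nat.add_mul_mod_self_left, Nat.mod_eq_of_lt ht]
    have hdiv : (t + q ^ r * g r t) / q ^ r = g r t := by
      rw [Nat.add_mul_div_left _ _ hpos, Nat.div_eq_of_lt ht, zero_add]
    refine ⟨t + q ^ r * g r t, ?_, fun i hi => ?_⟩
    · rw [pow_succ]
      have := hg r t
      nlinarith
    · rcases Nat.lt_succ_iff_lt_or_eq.mp hi with hi | rfl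
      · rw [← mod_pow_mod_pow hi (t + q ^ r * g r t), ← mod_pow_div_pow hi (t + q ^ r * g r t),
          hmod]
        exact h i hi
      · rw [hmod, hdiv, Nat.mod_eq_of_lt (hg _ _)]

section Leaves

variable {n : ℕ} (R : ℕ → ℕ → Prop) (q p : ℕ)

open Classical in
/-- The oriented edges of `G` that the leaf `t` has to know. -/
noncomputable def needed (G : SimpleGraph (Fin n)) (T : ℕ → ℕ → Fin n → ℕ) (t : ℕ) :
    Finset (Fin n × Fin n) :=
  {e | G.Adj e.1 e.2 ∧ ∃ i < p, ∃ j < i, R j i ∧ e.1 ∈ part q T i t ∧ e.2 ∈ part q T j t}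

variable {R q p}

theorem mem_needed {G : SimpleGraph (Fin n)} {T : ℕ → ℕ → Fin n → ℕ} {t : ℕ}
    {e : Fin n × Fin n} : e ∈ needed R q p G T t ↔ G.Adj e.1 e.2 ∧
      ∃ i < p, ∃ j < i, R j i ∧ e.1 ∈ part q T i t ∧ e.2 ∈ part q T j t := by
  simp [needed]

theorem card_needed_le (G : SimpleGraph (Fin n)) (T : ℕ → ℕ → Fin n → ℕ) (t : ℕ) :
    #(needed R q p G T t) ≤ ∑ i ∈ range p, ∑ v ∈ part q T i t, crossDegree R q G T i t v := by
  classical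
  have : needed R q p G T t ⊆ (range p).biUnion fun i => (part q T i t).biUnion fun v =>
      ({j ∈ range i | R j i} : Finset ℕ).biUnion fun j =>
        (nbr G v ∩ part q T j t).image (Prod.mk v) := by
    rintro ⟨v, u⟩ he
    obtain ⟨hG, i, hi, j, hj, hR, hv, hu⟩ := mem_needed.mp he
    simp only [mem_biUnion, mem_image, mem_inter, mem_nbr, mem_filter, mem_range]
    exact ⟨i, hi, v, hv, j, ⟨hj, hR⟩, u, ⟨hG, hu⟩, rfl⟩
  refine (card_le_card this).trans (card_biUnion_le.trans (sum_le_sum fun i _ =>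
    card_biUnion_le.trans (sum_le_sum fun v _ => card_biUnion_le.trans
      (sum_le_sum fun j _ => card_image_le))))

/-- The number of leaves that have to know an edge. -/
theorem card_leaves_le (hq : 0 < q) (G : SimpleGraph (Fin n)) (T : ℕ → ℕ → Fin n → ℕ)
    (e : Fin n × Fin n) : #{t ∈ range (q ^ p) | e ∈ needed R q p G T t} * q ^ 2 ≤
      (∑ i ∈ range p, backDegree R i) * q ^ p := by
  classical
  have h1 : ({t ∈ range (q ^ p) | e ∈ needed R q p G T t} : Finset ℕ) ⊆
      (range p).biUnion fun i => ({j ∈ range i | R j i} : Finset ℕ).biUnion fun j =>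
        {t ∈ range (q ^ p) | e.1 ∈ part q T i t ∧ e.2 ∈ part q T j t} := by
    intro t ht
    obtain ⟨ht, he⟩ := mem_filter.mp ht
    obtain ⟨hG, i, hi, j, hj, hR, hv, hu⟩ := mem_needed.mp he
    simp only [mem_biUnion, mem_filter, mem_range]
    exact ⟨i, hi, j, ⟨hj, hR⟩, mem_range.mp ht, hv, hu⟩
  have h2 : ∀ i < p, ∀ j < i,
      #{t ∈ range (q ^ p) | e.1 ∈ part q T i t ∧ e.2 ∈ part q T j t} * q ^ 2 ≤ q ^ p := by
    intro i hi j hj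
    have h3 := card_prescribed_digits hq
      (fun i' s => if i' = i then T i s e.1 else T j s e.2) {i, j} p
    have h4 : #{i' ∈ ({i, j} : Finset ℕ) | i' < p} = 2 := by
      rw [filter_true_of_mem, card_pair hj.ne']
      intro i' h
      rcases mem_insert.mp h with rfl | h
      · exact hi
      · rw [mem_singleton.mp h]
        exact hj.trans hi
    rw [h4] at h3
    refine le_trans (Nat.mul_le_mul_right _ (card_le_card fun t => ?_)) h3
    simp only [mem_filter, part, mem_univ, true_and, mem_insert, mem_singleton]
    rintro ⟨ht, h1, h2⟩
    refine ⟨ht, ?_⟩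
    rintro i' (rfl | rfl) _
    · simpa using h1
    · rw [if_neg hj.ne]
      exact h2
  refine (Nat.mul_le_mul_right _ ((card_le_card h1).trans (card_biUnion_le.trans
    (sum_le_sum fun i _ => card_biUnion_le)))).trans ?_
  rw [sum_mul, sum_mul]
  refine sum_le_sum fun i hi => ?_
  rw [sum_mul, backDegree, ← smul_eq_mul (a := #_)]
  exact sum_le_card_nsmul _ _ _ fun j hj =>
    h2 i (mem_range.mp hi) j (mem_range.mp (mem_filter.mp hj).1)

end Leaves

section Learning

variable {n : ℕ}

/-- All degrees are known: only graphs with the degrees `δ` are possible. -/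
def degreesKnown (δ : Fin n → ℕ) : Knowledge (Fin n) (SimpleGraph (Fin n)) := fun v G G' =>
  (∀ w, #(nbr G w) = δ w) ∧ (∀ w, #(nbr G' w) = δ w) ∧ nbr G v = nbr G' v

/-- The first `i` levels of the partition tree are known as well. -/
def treeKnown (δ : Fin n → ℕ) (R : ℕ → ℕ → Prop) (q M i : ℕ) :
    Knowledge (Fin n) (SimpleGraph (Fin n)) := fun v G G' =>
  degreesKnown δ v G G' ∧ ∀ j < i, ∀ s < q ^ j, tree R q M G j s = tree R q M G' j s

variable {δ : Fin n → ℕ} {R : ℕ → ℕ → Prop} {q M p W : ℕ}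

theorem card_nbr_le (G : SimpleGraph (Fin n)) (v : Fin n) : #(nbr G v) ≤ n :=
  (card_le_univ _).trans (by simp)

theorem tree_monotone (G : SimpleGraph (Fin n)) (i s : ℕ) : Monotone (tree R q M G i s) := by
  rw [tree]
  exact intervalPartition_monotone _ _ _

theorem tree_lt (hq : 0 < q) (G : SimpleGraph (Fin n)) (i s : ℕ) (v : Fin n) :
    tree R q M G i s v < q := by
  rw [tree]
  exact intervalPartition_lt hq _ _ _

theorem lt_iff_of_monotone {g : Fin n → ℕ} (hg : Monotone g) (v : Fin n) (b : ℕ) :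
    g v < b ↔ (v : ℕ) < #{u | g u < b} := by
  constructor
  · intro h
    have : Iic v ⊆ ({u | g u < b} : Finset (Fin n)) := fun u hu =>
      mem_filter.mpr ⟨mem_univ _, (hg (mem_Iic.mp hu)).trans_lt h⟩
    have := card_le_card this
    rw [Fin.card_Iic] at this
    omega
  · intro h
    by_contra hb
    have : ({u | g u < b} : Finset (Fin n)) ⊆ Iio v := by
      intro u hu
      rw [mem_Iio]
      by_contra huv
      exact hb ((hg (not_lt.mp huv)).trans_lt (mem_filter.mp hu).2)
    have := card_le_card this
    rw [Fin.card_Iio] at this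
    omega

/-- One more level of the partition tree becomes known in three rounds: the prefixes, as nodes,
collect the weights, compute their partitions and publish them, as lists of interval ends. -/
theorem Reach.treeLevel (hq : 0 < q) {i : ℕ} (hi : q ^ (i + 1) ≤ n) (hin : i * n < W)
    (hnW : n < W) : Reach W 3 (treeKnown δ R q M i) (treeKnown δ R q M (i + 1)) := by
  have hqi : 0 < q ^ i := by positivity
  let ends : SimpleGraph (Fin n) → ℕ → ℕ := fun G y =>
    #{v | tree R q M G i (y % q ^ i) v < y / q ^ i}
  have hends : ∀ G y, ends G y < W := fun G y =>
    ((card_le_univ _).trans (by simp)).trans_lt hnW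
  refine Reach.trans (r := 1) (s := 2) (Reach.word (fun (v x : Fin n) G =>
    if (x : ℕ) < q ^ i then crossDegree R q G (tree R q M G) i x v else 0) ?_ ?_)
    (Reach.trans (r := 1) (s := 1) (Reach.word (fun (x y : Fin n) G =>
      if (y : ℕ) % q ^ i = x then ends G y else 0) ?_ ?_)
    ((Reach.word (fun (y _ : Fin n) G => ends G y) (fun _ _ _ => hends _ _) ?_).mono_right ?_))
  · intro u v G
    split_ifs
    · exact (crossDegree_le _ _ _ _ _).trans_lt hin
    · exact Nat.zero_lt_of_lt hnW
  · rintro v x G G' ⟨⟨_, _, h⟩, h'⟩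
    split_ifs
    · exact crossDegree_congr hq h' h
    · rfl
  · intro u v G
    split_ifs
    · exact hends _ _
    · exact Nat.zero_lt_of_lt hnW
  · rintro x y G G' ⟨⟨⟨h1, h2, _⟩, _⟩, h⟩
    split_ifs with hy
    · have hx : (x : ℕ) < q ^ i := hy ▸ Nat.mod_lt _ hqi
      simp only [hx, if_true] at h
      have : tree R q M G i x = tree R q M G' i x := by
        rw [tree_eq hq, tree_eq hq]
        simp only [levelWeight, h, h1, h2]
      simp only [ends, hy, this]
    · rfl
  · rintro y v G G' ⟨_, h⟩
    have := h ⟨y % q ^ i, (Nat.mod_lt _ hqi).trans_le ((Nat.pow_le_pow_right hq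
      (Nat.le_succ i)).trans hi)⟩
    simpa using this
  · rintro v G G' ⟨⟨⟨hK, _⟩, _⟩, h⟩
    refine ⟨hK.1, fun j hj s hs => ?_⟩
    rcases Nat.lt_succ_iff_lt_or_eq.mp hj with hj | rfl
    · exact hK.2 j hj s hs
    · have key : ∀ b < q, ∀ u, tree R q M G j s u < b ↔ tree R q M G' j s u < b := by
        intro b hb u
        have hy : s + q ^ j * b < n := by
          refine lt_of_lt_of_le ?_ hi
          rw [pow_succ]
          nlinarith
        have := h ⟨s + q ^ j * b, hy⟩
        simp only [ends, Nat.add_mul_mod_self_left, Nat.mod_eq_of_lt hs,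
          Nat.add_mul_div_left _ _ hqi, Nat.div_eq_of_lt hs, zero_add] at this
        rw [lt_iff_of_monotone (tree_monotone G j s), lt_iff_of_monotone (tree_monotone G' j s),
          this]
      funext u
      have h1 := tree_lt (R := R) (M := M) hq G j s u
      have h2 := tree_lt (R := R) (M := M) hq G' j s u
      have h3 := key _ h1 u
      have h4 := key _ h2 u
      omega

theorem Reach.buildTree (hq : 0 < q) (hqn : q ^ p ≤ n) (hpn : p ≤ n) (hW : n * n < W) (hnW : n < W) :
    ∀ i ≤ p, Reach W (3 * i) (degreesKnown δ) (treeKnown δ R q M i)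
  | 0, _ => .refl fun _ _ _ h => ⟨h, fun _ hj => absurd hj (Nat.not_lt_zero _)⟩
  | i + 1, hi => (Reach.buildTree hq hqn hpn hW hnW i (Nat.le_of_succ_le hi)).trans
      (Reach.treeLevel hq ((Nat.pow_le_pow_right hq hi).trans hqn)
        ((Nat.mul_le_mul_right n (by omega)).trans_lt hW) hnW)

theorem part_congr {T T' : ℕ → ℕ → Fin n → ℕ} (hq : 0 < q)
    (h : ∀ j < p, ∀ s < q ^ j, T j s = T' j s) {j : ℕ} (hj : j < p) (t : ℕ) :
    part q T j t = part q T' j t := by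
  simp only [part, h j hj _ (Nat.mod_lt t (Nat.pow_pos hq))]

theorem mem_needed_congr {G G' : SimpleGraph (Fin n)} {T T' : ℕ → ℕ → Fin n → ℕ} (hq : 0 < q)
    (h : ∀ j < p, ∀ s < q ^ j, T j s = T' j s) {e : Fin n × Fin n}
    (he : G.Adj e.1 e.2 ↔ G'.Adj e.1 e.2) (t : ℕ) :
    e ∈ needed R q p G T t ↔ e ∈ needed R q p G' T' t := by
  rw [mem_needed, mem_needed, he]
  refine and_congr_right fun _ => exists_congr fun i => and_congr_right fun hi =>
    exists_congr fun j => and_congr_right fun hj => ?_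
  rw [part_congr hq h hi, part_congr hq h (hj.trans hi)]

/-- What is known at the end: every leaf knows the edges that it needs. -/
def leavesKnown (δ : Fin n → ℕ) (R : ℕ → ℕ → Prop) (q M p : ℕ) :
    Knowledge (Fin n) (SimpleGraph (Fin n)) := fun v G G' =>
  treeKnown δ R q M p v G G' ∧ ((v : ℕ) < q ^ p →
    needed R q p G (tree R q M G) v =
      needed R q p G' (tree R q M G') v)

/-- The number of edges that a leaf needs. -/
theorem card_needed_le_div (hq : 0 < q) (hqn : q ≤ n) (G : SimpleGraph (Fin n))
    (hM : ∑ v, #(nbr G v) ≤ 2 * M) (hM' : n * q ≤ M) (t : ℕ) :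
    #(needed R q p G (tree R q M G) t) ≤
      72 * (∑ i ∈ range p, backDegree R i) * M / q ^ 2 := by
  rw [Nat.le_div_iff_mul_le (by positivity)]
  have h1 : (#(needed R q p G (tree R q M G) t) : ℝ) ≤
      ∑ i ∈ range p, 6 * (12 * (backDegree R i : ℝ) * M / q ^ 2) := by
    refine le_trans (Nat.cast_le.mpr (card_needed_le G _ t)) ?_
    push_cast
    exact sum_le_sum fun i _ => (tree_balanced hq hqn G hM hM' i t).2.2
  have h2 : ∑ i ∈ range p, 6 * (12 * (backDegree R i : ℝ) * M / q ^ 2) =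
      72 * (∑ i ∈ range p, (backDegree R i : ℝ)) * M / q ^ 2 := by
    rw [mul_sum, sum_mul, sum_div]
    exact sum_congr rfl fun i _ => by ring
  rw [h2, le_div_iff₀ (by positivity)] at h1
  exact_mod_cast h1

/-- The edges are spread evenly over the nodes and are then routed to the leaves. -/
theorem Reach.leaves (hq : 0 < q) (hp : p ≠ 0) (hqn : q ^ p ≤ n) (hδM : ∑ v, δ v ≤ 2 * M)
    (hM : n * q ≤ M) (hW : 4 * n ^ 5 < W) (hnW : n < W) :
    Reach W (1 + 496 * (72 * (∑ i ∈ range p, backDegree R i) * M / q ^ 2 / n + 1))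
      (treeKnown δ R q M p) (leavesKnown δ R q M p) := by
  classical
  have hqn' : q ≤ n := (Nat.le_self_pow hp q).trans hqn
  have hn : 0 < n := hq.trans_le hqn'
  set S := 72 * (∑ i ∈ range p, backDegree R i) * M / q ^ 2 with hSdef
  let holder : SimpleGraph (Fin n) → Fin n × Fin n → ℕ := fun G e =>
    position (nbr G) e.1 e.2 % n
  let Q : Fin n → Fin n → SimpleGraph (Fin n) → Finset (Fin n) := fun u x G =>
    {w ∈ nbr G u | holder G (u, w) = x}
  let A : SimpleGraph (Fin n) → Finset ((Fin n × Fin n) × (Fin n × Fin n)) := fun G =>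
    if ∀ w, #(nbr G w) = δ w then
      univ.filter fun x => x.2 ∈ needed R q p G (tree R q M G) x.1.2 ∧
        (x.1.2 : ℕ) < q ^ p ∧ holder G x.2 = x.1.1 else ∅
  have hA : ∀ G, (∀ w, #(nbr G w) = δ w) → ∀ x, x ∈ A G ↔
      x.2 ∈ needed R q p G (tree R q M G) x.1.2 ∧ (x.1.2 : ℕ) < q ^ p ∧
        holder G x.2 = x.1.1 := by
    intro G hG x
    simp only [A, if_pos hG, mem_filter, mem_univ, true_and]
  have hA0 : ∀ G, (¬ ∀ w, #(nbr G w) = δ w) → A G = ∅ := fun G hG => if_neg hG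
  have hP : Fintype.card ((Fin n × Fin n) × (Fin n × Fin n)) = n ^ 4 := by
    simp only [Fintype.card_prod, Fintype.card_fin]; ring
  refine Reach.trans (Reach.packets Q (by simpa using hnW) ?_ ?_)
    ((Reach.route (S := S) hn A (fun x => x.1.1) (fun x => x.1.2) ?_ ?_ ?_ ?_).mono_right ?_)
  · intro u x G
    refine card_le_one.mpr fun w hw w' hw' => ?_
    obtain ⟨h1, h2⟩ := mem_filter.mp hw
    obtain ⟨h3, h4⟩ := mem_filter.mp hw'
    have h5 : rank (nbr G u) w ≡ rank (nbr G u) w' [MOD n] :=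
      Nat.ModEq.add_left_cancel' _ (h2.trans h4.symm)
    exact rank_injOn _ h1 h3 (h5.eq_of_lt_of_lt ((rank_lt h1).trans_le (card_nbr_le G u))
      ((rank_lt h3).trans_le (card_nbr_le G u)))
  · rintro u x G G' ⟨⟨h1, h2, h3⟩, _⟩
    simp only [Q, holder, position, h1, h2, h3]
  · rw [hP]
    calc n ^ 4 * (4 * n) = 4 * n ^ 5 := by ring
      _ < W := hW
  · rintro x G G' ⟨⟨⟨h1, h2, _⟩, hT⟩, h⟩
    have hQ : ∀ e : Fin n × Fin n, (G.Adj e.1 e.2 ∧ holder G e = x) ↔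
        (G'.Adj e.1 e.2 ∧ holder G' e = x) := by
      intro e
      have := Finset.ext_iff.mp (h e.1) e.2
      simpa only [Q, mem_filter, mem_nbr] using this
    ext y
    rw [mem_held, mem_held, hA G h1, hA G' h2]
    constructor
    · rintro ⟨⟨ha, hb, hc⟩, rfl⟩
      have hadj := (mem_needed.mp ha).1
      have hadj' := (hQ y.2).mp ⟨hadj, hc⟩
      exact ⟨⟨(mem_needed_congr hq hT (iff_of_true hadj hadj'.1) _).mp ha, hb, hadj'.2⟩, rfl⟩
    · rintro ⟨⟨ha, hb, hc⟩, rfl⟩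
      have hadj := (mem_needed.mp ha).1
      have hadj' := (hQ y.2).mpr ⟨hadj, hc⟩
      exact ⟨⟨(mem_needed_congr hq hT (iff_of_true hadj'.1 hadj) _).mpr ha, hb, hadj'.2⟩, rfl⟩
  · intro G x
    by_cases hG : ∀ w, #(nbr G w) = δ w
    swap
    · simp [hA0 G hG]
    let E : Finset (Fin n × Fin n) := {e | e.2 ∈ nbr G e.1}
    have hE : #{e ∈ E | holder G e = x} ≤ 2 * M / n + 1 := by
      refine card_filter_mod_le E (fun e => position (nbr G) e.1 e.2) n x ?_ ?_
      · intro e he e' he' h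
        obtain ⟨h1, h2⟩ := position_inj (mem_filter.mp he).2 (mem_filter.mp he').2 h
        exact Prod.ext h1 h2
      · intro e he
        refine (position_lt (mem_filter.mp he).2).trans_le ?_
        simpa only [hG] using hδM
    have h1 : #{y ∈ A G | y.1.1 = x} ≤ ∑ e ∈ E with holder G e = x,
        #{t ∈ range (q ^ p) | e ∈ needed R q p G (tree R q M G) t} := by
      rw [← card_sigma]
      refine card_le_card_of_injOn (fun y => ⟨y.2, y.1.2⟩) (fun y hy => ?_) fun y hy y' hy' h => ?_
      · obtain ⟨hyA, rfl⟩ := mem_filter.mp (mem_coe.mp hy)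
        obtain ⟨ha, hb, hc⟩ := (hA G hG y).mp hyA
        simp only [coe_sigma, Set.mem_sigma_iff, mem_coe, mem_filter, mem_range, E, mem_univ,
          true_and, mem_nbr]
        exact ⟨⟨(mem_needed.mp ha).1, hc⟩, hb, ha⟩
      · have h1 := (mem_filter.mp (mem_coe.mp hy)).2
        have h2 := (mem_filter.mp (mem_coe.mp hy')).2
        simp only [Sigma.mk.injEq, heq_eq_eq, Fin.val_inj] at h
        exact Prod.ext (Prod.ext (h1.trans h2.symm) h.2) h.1
    rw [hSdef, Nat.le_div_iff_mul_le (by positivity)]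
    calc _ ≤ (∑ e ∈ E with holder G e = x,
          #{t ∈ range (q ^ p) | e ∈ needed R q p G (tree R q M G) t}) * q ^ 2 :=
          Nat.mul_le_mul_right _ h1
      _ ≤ #{e ∈ E | holder G e = x} * ((∑ i ∈ range p, backDegree R i) * q ^ p) := by
          rw [sum_mul, ← smul_eq_mul (a := #_)]
          exact sum_le_card_nsmul _ _ _ fun e _ => card_leaves_le hq G _ e
      _ ≤ (2 * M / n + 1) * ((∑ i ∈ range p, backDegree R i) * n) := by gcongr
      _ = (2 * M / n * n + n) * (∑ i ∈ range p, backDegree R i) := by ring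
      _ ≤ (72 * M) * (∑ i ∈ range p, backDegree R i) := by
          refine Nat.mul_le_mul_right _ ?_
          have := Nat.div_mul_le_self (2 * M) n
          have : n ≤ n * q := Nat.le_mul_of_pos_right n hq
          omega
      _ = _ := by ring
  · intro G t
    by_cases hG : ∀ w, #(nbr G w) = δ w
    swap
    · simp [hA0 G hG]
    refine le_trans ?_ (card_needed_le_div hq hqn' G (by simpa only [hG] using hδM) hM t)
    refine card_le_card_of_injOn (fun y => y.2) (fun y hy => ?_) fun y hy y' hy' h => ?_
    · obtain ⟨hyA, rfl⟩ := mem_filter.mp (mem_coe.mp hy)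
      exact ((hA G hG y).mp hyA).1
    · obtain ⟨h1, h2⟩ := mem_filter.mp (mem_coe.mp hy)
      obtain ⟨h3, h4⟩ := mem_filter.mp (mem_coe.mp hy')
      have h5 := ((hA G hG y).mp h1).2.2
      have h6 := ((hA G hG y').mp h3).2.2
      simp only at h
      rw [← h, h5, Fin.val_inj] at h6
      exact Prod.ext (Prod.ext h6 (h2.trans h4.symm)) h
  · rintro t G G' ⟨⟨hK, _⟩, h⟩
    refine ⟨hK, fun ht => ?_⟩
    have key : ∀ G, (∀ w, #(nbr G w) = δ w) → ∀ e,
        e ∈ needed R q p G (tree R q M G) t ↔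
          ∃ x, ((x, t), e) ∈ held A (fun _ y => y.1.2) t G := by
      intro G hG e
      simp only [mem_held, hA G hG, and_true]
      exact ⟨fun he => ⟨⟨holder G e, Nat.mod_lt _ hn⟩, he, ht, rfl⟩, fun ⟨_, he, _⟩ => he⟩
    ext e
    rw [key G hK.1.1, key G' hK.1.2.1, h]

end Learning

section Protocols

variable {V Ω : Type}

/-- What the nodes know after `t` rounds in which they send the messages `msg`. -/
def view (K : Knowledge V Ω) (msg : ℕ → V → V → Ω → ℕ) (t : ℕ) : Knowledge V Ω := fun v ω ω' =>
  K v ω ω' ∧ ∀ s < t, ∀ u, msg s u v ω = msg s u v ω'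

theorem Reach.exists_messages {W r : ℕ} (hW : 0 < W) {K K' : Knowledge V Ω}
    (h : Reach W r K K') : ∃ msg : ℕ → V → V → Ω → ℕ, (∀ t u v ω, msg t u v ω < W) ∧
      (∀ t < r, ∀ u v ω ω', view K msg t u ω ω' → msg t u v ω = msg t u v ω') ∧
      ∀ v ω ω', view K msg r v ω ω' → K' v ω ω' := by
  induction h with
  | refl h =>
    exact ⟨fun _ _ _ _ => 0, fun _ _ _ _ => hW, fun _ _ _ _ _ _ _ => rfl,
      fun v ω ω' hv => h _ _ _ hv.1⟩
  | @step r K K₁ K' hs _ ih =>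
    obtain ⟨m, hm1, hm2, hm3⟩ := hs
    obtain ⟨msg, h1, h2, h3⟩ := ih
    let msg' : ℕ → V → V → Ω → ℕ := fun t => Nat.casesOn t m msg
    have hview : ∀ t v ω ω', view K msg' (t + 1) v ω ω' → view K₁ msg t v ω ω' := by
      rintro t v ω ω' ⟨hK, h⟩
      exact ⟨hm3 _ _ _ hK (h 0 (Nat.succ_pos t)), fun s hs => h (s + 1) (Nat.succ_lt_succ hs)⟩
    refine ⟨msg', ?_, ?_, fun v ω ω' h => h3 _ _ _ (hview _ _ _ _ h)⟩
    · rintro (_ | t) u v ω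
      · exact hm1 _ _ _
      · exact h1 _ _ _ _
    · rintro (_ | t) ht u v ω ω' h
      · exact hm2 _ _ _ _ h.1
      · exact h2 t (Nat.lt_of_succ_lt_succ ht) u v ω ω' (hview _ _ _ _ h)

end Protocols

/-- The message that consists of the `B` lowest bits of a number. -/
def bitMessage (B x : ℕ) : Message B := ⟨List.ofFn fun i : Fin B => x.testBit i, by simp⟩

theorem bitMessage_inj {B x y : ℕ} (hx : x < 2 ^ B) (hy : y < 2 ^ B)
    (h : bitMessage B x = bitMessage B y) : x = y := by
  have h1 := List.ofFn_injective (Subtype.ext_iff.mp h)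
  apply Nat.eq_of_testBit_eq
  intro i
  by_cases hi : i < B
  · exact congrFun h1 ⟨i, hi⟩
  · have h2 : 2 ^ B ≤ 2 ^ i := Nat.pow_le_pow_right two_pos (not_lt.mp hi)
    rw [Nat.testBit_lt_two_pow (hx.trans_le h2), Nat.testBit_lt_two_pow (hy.trans_le h2)]

section Realization

variable {n : ℕ}

/-- At the beginning every node knows its neighbours. -/
def neighborsKnown (n : ℕ) : Knowledge (Fin n) (SimpleGraph (Fin n)) := fun v G G' =>
  nbr G v = nbr G' v

open Classical in
/-- The algorithm in which every node keeps track of the set of graphs that are possible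
according to what it has received, when the messages `msg` are sent, as functions of the graph,
and the output `out` is due after `T` rounds. -/
noncomputable def trackingAlgorithm (B : ℕ) {Out : Type}
    (msg : ℕ → Fin n → Fin n → SimpleGraph (Fin n) → ℕ) (T : SimpleGraph (Fin n) → ℕ)
    (out : Fin n → SimpleGraph (Fin n) → Out) : Algorithm n B Out where
  State := ℕ × Set (SimpleGraph (Fin n))
  init v N := (0, {G | G.neighborSet v = N})
  output v s := if h : ∃ G ∈ s.2, T G ≤ s.1 then some (out v h.choose) else none
  send v s w := if h : s.2.Nonempty then bitMessage B (msg s.1 v w h.some) else Message.empty B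
  receive v s m := (s.1 + 1, {G ∈ s.2 | ∀ u, bitMessage B (msg s.1 u v G) = m u})

theorem trackingAlgorithm_haltsWith {B : ℕ} {Out : Type}
    {msg : ℕ → Fin n → Fin n → SimpleGraph (Fin n) → ℕ} {T : SimpleGraph (Fin n) → ℕ}
    {out : Fin n → SimpleGraph (Fin n) → Out} (hB : ∀ t u v G, msg t u v G < 2 ^ B)
    (hmsg : ∀ t u v G G', t < T G → view (neighborsKnown n) msg t u G G' →
      msg t u v G = msg t u v G')
    (hT : ∀ t v G G', view (neighborsKnown n) msg t v G G' → T G' ≤ t → T G ≤ t)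
    (hout : ∀ v G G', view (neighborsKnown n) msg (T G) v G G' → out v G = out v G')
    (G : SimpleGraph (Fin n)) :
    (trackingAlgorithm B msg T out).HaltsWith G (T G) fun v => out v G := by
  classical
  set A := trackingAlgorithm B msg T out
  have hrun : ∀ t ≤ T G, ∀ v, A.run G t v =
      (t, {G' | view (neighborsKnown n) msg t v G G'}) := by
    intro t
    induction t with
    | zero =>
      intro _ v
      refine Prod.ext rfl (Set.ext fun G' => ?_)
      show G'.neighborSet v = G.neighborSet v ↔ _
      simp only [view, neighborsKnown, Nat.not_lt_zero, false_imp_iff, implies_true, and_true,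
        Set.mem_ofPred_eq, Set.ext_iff, Finset.ext_iff, mem_nbr, SimpleGraph.mem_neighborSet]
      exact forall_congr' fun _ => iff_comm
    | succ t ih =>
      intro ht v
      have ih' := ih (Nat.le_of_succ_le ht)
      have hnone : ∀ u, A.output u (A.run G t u) = none := by
        intro u
        rw [ih']
        refine dif_neg ?_
        rintro ⟨G', hG', h⟩
        have := hT t u G G' hG' h
        omega
      have hsend : ∀ u, A.transmitted (A.run G t) u v = bitMessage B (msg t u v G) := by
        intro u
        simp only [Algorithm.transmitted, hnone]
        rw [ih']
        have hne : ({G' | view (neighborsKnown n) msg t u G G'} :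
            Set (SimpleGraph (Fin n))).Nonempty := ⟨G, rfl, fun _ _ _ => rfl⟩
        exact (dif_pos hne).trans (congrArg _ (hmsg t u v G _ ht hne.some_mem).symm)
      show A.step (A.run G t) v = _
      simp only [Algorithm.step, hnone, hsend]
      rw [ih']
      refine Prod.ext rfl (Set.ext fun G' => ?_)
      show (view (neighborsKnown n) msg t v G G' ∧
        ∀ u, bitMessage B (msg t u v G') = bitMessage B (msg t u v G)) ↔ _
      simp only [Set.mem_ofPred_eq, view]
      constructor
      · rintro ⟨⟨h1, h2⟩, h3⟩
        refine ⟨h1, fun s hs u => ?_⟩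
        rcases Nat.lt_succ_iff_lt_or_eq.mp hs with hs | rfl
        · exact h2 s hs u
        · exact (bitMessage_inj (hB _ _ _ _) (hB _ _ _ _) (h3 u)).symm
      · rintro ⟨h1, h2⟩
        exact ⟨⟨h1, fun s hs => h2 s (hs.trans (Nat.lt_succ_self t))⟩,
          fun u => by rw [h2 t (Nat.lt_succ_self t) u]⟩
  intro v
  rw [hrun _ le_rfl]
  have h : ∃ G' ∈ ({G' | view (neighborsKnown n) msg (T G) v G G'} :
      Set (SimpleGraph (Fin n))), T G' ≤ T G := ⟨G, ⟨rfl, fun _ _ _ => rfl⟩, le_rfl⟩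
  exact (dif_pos h).trans (congrArg some (hout v G _ h.choose_spec.1).symm)

/-- If, for every possible list of degrees, a number of rounds that may depend on it suffices to
know the output, then there is an algorithm that first publishes the degrees. -/
theorem exists_algorithm {B : ℕ} {Out : Type} (hn : n < 2 ^ B) (r : (Fin n → ℕ) → ℕ)
    (out : Fin n → SimpleGraph (Fin n) → Out) (K : (Fin n → ℕ) → Knowledge (Fin n) _)
    (hr : ∀ δ, Reach (2 ^ B) (r δ) (degreesKnown δ) (K δ))
    (hK : ∀ δ v G G', K δ v G G' → out v G = out v G') :
    ∃ A : Algorithm n B Out, ∀ G, A.HaltsWith G (1 + r fun v => #(nbr G v)) fun v => out v G := by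
  choose m hm1 hm2 hm3 using fun δ => (hr δ).exists_messages (by positivity)
  let deg : SimpleGraph (Fin n) → Fin n → ℕ := fun G v => #(nbr G v)
  let msg : ℕ → Fin n → Fin n → SimpleGraph (Fin n) → ℕ := fun t u v G =>
    Nat.casesOn t (deg G u) fun t => m (deg G) t u v G
  have hdeg : ∀ t v G G', view (neighborsKnown n) msg (t + 1) v G G' → deg G = deg G' :=
    fun t v G G' h => funext fun u => h.2 0 (Nat.succ_pos t) u
  have hview : ∀ t v G G', view (neighborsKnown n) msg (t + 1) v G G' →
      view (degreesKnown (deg G)) (m (deg G)) t v G G' := by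
    intro t v G G' h
    have h1 := hdeg t v G G' h
    refine ⟨⟨fun _ => rfl, fun w => (congrFun h1 w).symm, h.1⟩, fun s hs u => ?_⟩
    have := h.2 (s + 1) (Nat.succ_lt_succ hs) u
    simpa only [msg, ← h1] using this
  refine ⟨trackingAlgorithm B msg (fun G => 1 + r (deg G)) out,
    trackingAlgorithm_haltsWith ?_ ?_ ?_ ?_⟩
  · rintro (_ | t) u v G
    · exact (card_nbr_le G u).trans_lt hn
    · exact hm1 _ _ _ _ _
  · rintro (_ | t) u v G G' ht h
    · exact congrArg card h.1
    · have h1 := hm2 (deg G) t (by omega) u v G G' (hview t u G G' h)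
      simpa only [msg, ← hdeg t u G G' h] using h1
  · rintro (_ | t) v G G' h ht
    · omega
    · rwa [hdeg t v G G' h]
  · intro v G G' h
    rw [Nat.add_comm 1] at h
    exact hK _ _ _ _ (hm3 _ v G G' (hview _ v G G' h))

end Realization

section Listing

variable {n p : ℕ}

/-- The adjacency of `H`, as a relation on the natural numbers. -/
def patternAdj (H : SimpleGraph (Fin p)) (j i : ℕ) : Prop :=
  ∃ (hj : j < p) (hi : i < p), H.Adj ⟨j, hj⟩ ⟨i, hi⟩

theorem sum_backDegree_le (H : SimpleGraph (Fin p)) :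
    ∑ i ∈ range p, backDegree (patternAdj H) i ≤ H.edgeSet.ncard := by
  classical
  have h1 : ∀ i : Fin p, backDegree (patternAdj H) i = #{j : Fin p | j < i ∧ H.Adj j i} := by
    intro i
    rw [backDegree, ← card_map Fin.valEmbedding]
    congr 1
    ext j
    simp only [mem_filter, mem_range, mem_map, mem_univ, true_and, Fin.valEmbedding_apply]
    constructor
    · rintro ⟨hji, hj, _, h⟩
      exact ⟨⟨j, hj⟩, ⟨hji, h⟩, rfl⟩
    · rintro ⟨j, ⟨hji, h⟩, rfl⟩
      exact ⟨hji, j.2, i.2, h⟩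
  rw [sum_range]
  simp only [h1]
  rw [← card_sigma, ← SimpleGraph.coe_edgeFinset, Set.ncard_coe_finset]
  refine card_le_card_of_injOn (fun x => s(x.2, x.1)) (fun x hx => ?_) fun x hx y hy h => ?_
  · simp only [coe_sigma, Set.mem_sigma_iff, mem_coe, mem_filter] at hx
    simpa using hx.2.2.2
  · simp only [coe_sigma, Set.mem_sigma_iff, mem_coe, mem_filter] at hx hy
    have h2 := hx.2.2.1
    have h3 := hy.2.2.1
    rcases Sym2.eq_iff.mp h with ⟨h4, h5⟩ | ⟨h4, h5⟩
    · exact Sigma.ext h5 (heq_of_eq h4)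
    · rw [h4, h5] at h2
      exact absurd h3 h2.asymm

/-- The output of a leaf: the copies of `H` with every vertex in the selected part, all of whose
edges are known to the leaf. -/
def leafOutput (H : SimpleGraph (Fin p)) (q : ℕ) (T : ℕ → ℕ → Fin n → ℕ)
    (E : Finset (Fin n × Fin n)) (t : ℕ) : Set (Candidate n) :=
  {C | t < q ^ p ∧ ∃ φ : H ≃g C.coe, (∀ i : Fin p, (φ i : Fin n) ∈ part q T i t) ∧
    ∀ a b, C.Adj a b → (a, b) ∈ E ∨ (b, a) ∈ E}

theorem leafOutput_congr {H : SimpleGraph (Fin p)} {q : ℕ} (hq : 0 < q)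
    {T T' : ℕ → ℕ → Fin n → ℕ} (hT : ∀ j < p, ∀ s < q ^ j, T j s = T' j s)
    {E E' : Finset (Fin n × Fin n)} {t : ℕ} (hE : t < q ^ p → E = E') :
    leafOutput H q T E t = leafOutput H q T' E' t := by
  ext C
  refine and_congr_right fun ht => exists_congr fun φ => ?_
  rw [hE ht]
  refine and_congr_left fun _ => forall_congr' fun i => ?_
  rw [part_congr hq hT i.2]

theorem iUnion_leafOutput (H : SimpleGraph (Fin p)) (G : SimpleGraph (Fin n)) {q : ℕ}
    (hq : 0 < q) (hqn : q ^ p ≤ n) {T : ℕ → ℕ → Fin n → ℕ} (hT : ∀ i s v, T i s v < q) :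
    ⋃ v : Fin n, leafOutput H q T (needed (patternAdj H) q p G T v) v = copies H G := by
  ext C
  rw [Set.mem_iUnion]
  constructor
  · rintro ⟨t, _, φ, _, h⟩
    refine ⟨fun a b hab => ?_, ⟨φ⟩⟩
    rcases h a b hab with h | h
    · exact (mem_needed.mp h).1
    · exact (mem_needed.mp h).1.symm
  · rintro ⟨hG, ⟨φ⟩⟩
    let f : ℕ → ℕ → ℕ := fun i s => if h : i < p then T i s (φ ⟨i, h⟩) else 0
    obtain ⟨t, ht, h⟩ := exists_prescribed_digits hq f (fun i s => by
      simp only [f]; split_ifs; exacts [hT _ _ _, hq]) p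
    have hpart : ∀ i : Fin p, (φ i : Fin n) ∈ part q T i t := by
      intro i
      have := h i i.2
      simp only [f, i.2, dif_pos] at this
      exact mem_filter.mpr ⟨mem_univ _, this⟩
    refine ⟨⟨t, ht.trans_le hqn⟩, ht, φ, hpart, fun a b hab => ?_⟩
    have key : ∀ a b, C.Adj a b → ∀ i j : Fin p, (φ i : Fin n) = a → (φ j : Fin n) = b → j < i →
        (a, b) ∈ needed (patternAdj H) q p G T t := by
      rintro _ _ hab i j rfl rfl hji
      refine mem_needed.mpr ⟨hG _ _ hab, i, i.2, j, hji, ⟨j.2, i.2, ?_⟩, hpart i, hpart j⟩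
      exact (φ.map_adj_iff (v := j) (w := i)).mp hab.symm
    obtain ⟨i, hi⟩ := φ.surjective ⟨a, C.edge_vert hab⟩
    obtain ⟨j, hj⟩ := φ.surjective ⟨b, C.edge_vert hab.symm⟩
    rcases lt_trichotomy i j with hij | rfl | hij
    · exact .inr (key b a hab.symm j i (by rw [hj]) (by rw [hi]) hij)
    · rw [hi] at hj
      exact absurd (congrArg Subtype.val hj) hab.ne
    · exact .inl (key a b hab i j (by rw [hi]) (by rw [hj]) hij)

theorem sum_card_nbr (G : SimpleGraph (Fin n)) : ∑ v, #(nbr G v) = 2 * G.edgeSet.ncard := by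
  classical
  have h := G.sum_degrees_eq_twice_card_edges
  rw [← SimpleGraph.coe_edgeFinset, Set.ncard_coe_finset, ← h]
  refine sum_congr rfl fun v _ => ?_
  rw [← SimpleGraph.card_neighborFinset_eq_degree]
  congr 1
  ext u
  simp [mem_nbr]

/-- The number of edges, or `n q` if this is larger, as a function of the degrees. -/
def edgeBound (n q : ℕ) (δ : Fin n → ℕ) : ℕ := max ((∑ v, δ v + 1) / 2) (n * q)

theorem exists_listing_algorithm {B q : ℕ} (hq : 0 < q) (hp : p ≠ 0) (hqn : q ^ p ≤ n)
    (hpn : p ≤ n) (hB : 4 * n ^ 5 < 2 ^ B) (H : SimpleGraph (Fin p)) :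
    ∃ A : Algorithm n B (Set (Candidate n)), ∀ G : SimpleGraph (Fin n),
      ∃ out : Fin n → Set (Candidate n), A.HaltsWith G
        (1 + (3 * p + (1 + 496 * (72 * (∑ i ∈ range p, backDegree (patternAdj H) i) *
          max G.edgeSet.ncard (n * q) / q ^ 2 / n + 1)))) out ∧ ⋃ v, out v = copies H G := by
  have hn : 0 < n := (Nat.pow_pos hq).trans_le hqn
  have hnn : n * n < 2 ^ B := by
    refine lt_of_le_of_lt ?_ hB
    have : n * n ≤ n ^ 5 := by
      rw [← pow_two]
      exact Nat.pow_le_pow_right hn (by norm_num)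
    omega
  have hn' : n < 2 ^ B := (Nat.le_mul_of_pos_right n hn).trans_lt hnn
  let M := edgeBound n q
  let T : SimpleGraph (Fin n) → ℕ → ℕ → Fin n → ℕ := fun G =>
    tree (patternAdj H) q (M fun v => #(nbr G v)) G
  have hreach : ∀ δ, Reach (2 ^ B) (3 * p + (1 + 496 *
      (72 * (∑ i ∈ range p, backDegree (patternAdj H) i) * M δ / q ^ 2 / n + 1)))
      (degreesKnown δ) (leavesKnown δ (patternAdj H) q (M δ) p) := by
    intro δ
    refine (Reach.buildTree hq hqn hpn hnn hn' p le_rfl).trans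
      (Reach.leaves hq hp hqn ?_ (le_max_right _ _) hB hn')
    have := le_max_left ((∑ v, δ v + 1) / 2) (n * q)
    simp only [M, edgeBound]
    omega
  have hout : ∀ δ v G G', leavesKnown δ (patternAdj H) q (M δ) p v G G' →
      leafOutput H q (T G) (needed (patternAdj H) q p G (T G) v) v =
        leafOutput H q (T G') (needed (patternAdj H) q p G' (T G') v) v := by
    rintro δ v G G' ⟨⟨⟨h1, h2, _⟩, hT⟩, hE⟩
    have h1' : (fun v => #(nbr G v)) = δ := funext h1
    have h2' : (fun v => #(nbr G' v)) = δ := funext h2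
    simp only [T, h1', h2']
    exact leafOutput_congr hq hT hE
  obtain ⟨A, hA⟩ := exists_algorithm hn' _
    (fun v G => leafOutput H q (T G) (needed (patternAdj H) q p G (T G) v) v) _ hreach hout
  have hT : ∀ G i s v, T G i s v < q := fun G i s v => tree_lt hq G i s v
  refine ⟨A, fun G => ⟨_, ?_, iUnion_leafOutput H G hq hqn (hT G)⟩⟩
  have h := hA G
  have hM : M (fun v => #(nbr G v)) = max G.edgeSet.ncard (n * q) := by
    simp only [M, edgeBound, sum_card_nbr]
    congr 1
    omega
  rwa [hM] at h

end Listing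

/-- An algorithm that halts at once. -/
def trivialAlgorithm (n B : ℕ) {Out : Type} (o : Out) : Algorithm n B Out where
  State := Unit
  init _ _ := ()
  output _ _ := some o
  send _ _ _ := Message.empty B
  receive _ _ _ := ()

end CongestedClique

theorem theorem2 :
    ∃ (c : ℕ) (C : ℝ)
      (A : (n p : ℕ) → SimpleGraph (Fin p) →
        CongestedClique.Algorithm n (c * Nat.log 2 n) (Set (CongestedClique.Candidate n))),
      ∀ (n p : ℕ), 1 ≤ p → (p : ℝ) ≤ Real.logb 2 (n : ℝ) →
        ∀ (H : SimpleGraph (Fin p)) (G : SimpleGraph (Fin n)),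
          CongestedClique.ListsWithin (A n p H) H G
            (C * ((H.edgeSet.ncard : ℝ) * CongestedClique.mTilde G p
                / (n : ℝ) ^ (1 + 2 / (p : ℝ)) + (p : ℝ))) := by
  have key : ∀ (n p : ℕ) (H : SimpleGraph (Fin p)),
      ∃ A : CongestedClique.Algorithm n (16 * Nat.log 2 n) (Set (CongestedClique.Candidate n)),
        1 ≤ p → (p : ℝ) ≤ Real.logb 2 (n : ℝ) → ∀ G : SimpleGraph (Fin n),
          CongestedClique.ListsWithin A H G
            (142848 * ((H.edgeSet.ncard : ℝ) * CongestedClique.mTilde G p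
                / (n : ℝ) ^ (1 + 2 / (p : ℝ)) + (p : ℝ))) := by
    intro n p H
    by_cases h : 1 ≤ p ∧ (p : ℝ) ≤ Real.logb 2 (n : ℝ)
    swap
    · exact ⟨CongestedClique.trivialAlgorithm _ _ ∅, fun h1 h2 => absurd ⟨h1, h2⟩ h⟩
    obtain ⟨hp, hpn⟩ := h
    have hp0 : (0 : ℝ) < p := by exact_mod_cast hp
    have hp1 : (1 : ℝ) ≤ p := by exact_mod_cast hp
    have hn : 0 < n := by
      rcases Nat.eq_zero_or_pos n with rfl | hn
      · simp at hpn
        linarith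
      · exact hn
    have hn0 : (0 : ℝ) < n := by exact_mod_cast hn
    have h2p : (2 : ℝ) ^ (p : ℝ) ≤ n := (Real.le_logb_iff_rpow_le (by norm_num) hn0).mp hpn
    have h2p' : 2 ^ p ≤ n := by exact_mod_cast h2p
    set ρ : ℝ := (n : ℝ) ^ (1 / (p : ℝ)) with hρ
    have hρp : ρ ^ p = n := by
      rw [hρ, ← Real.rpow_natCast, ← Real.rpow_mul hn0.le, one_div_mul_cancel hp0.ne',
        Real.rpow_one]
    have hρ0 : 0 < ρ := by positivity
    have hρ2 : 2 ≤ ρ := by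
      refine le_of_pow_le_pow_left₀ (n := p) (by omega) hρ0.le ?_
      rw [hρp]
      exact_mod_cast h2p'
    obtain ⟨q, hqρ, hρq⟩ : ∃ q : ℕ, (q : ℝ) ≤ ρ ∧ ρ < q + 1 :=
      ⟨⌊ρ⌋₊, Nat.floor_le hρ0.le, Nat.lt_floor_add_one ρ⟩
    have hq1 : (1 : ℝ) < q := by linarith
    have hq : 0 < q := by
      have : (0 : ℝ) < q := by linarith
      exact_mod_cast this
    have hqn : q ^ p ≤ n := by
      have : (q : ℝ) ^ p ≤ n := by
        rw [← hρp]
        exact pow_le_pow_left₀ (by positivity) hqρ p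
      exact_mod_cast this
    have hn2 : 2 ≤ n := (Nat.le_self_pow (by omega) 2).trans h2p'
    have hB : 4 * n ^ 5 < 2 ^ (16 * Nat.log 2 n) := by
      have h1 : n < 2 ^ (Nat.log 2 n + 1) := Nat.lt_pow_succ_log_self (by norm_num) n
      have h2 : 1 ≤ Nat.log 2 n := Nat.log_pos (by norm_num) hn2
      calc 4 * n ^ 5 ≤ n ^ 2 * n ^ 5 := Nat.mul_le_mul_right _ (by nlinarith)
        _ = n ^ 7 := by ring
        _ < (2 ^ (Nat.log 2 n + 1)) ^ 7 := Nat.pow_lt_pow_left h1 (by norm_num)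
        _ = 2 ^ ((Nat.log 2 n + 1) * 7) := by rw [← pow_mul]
        _ ≤ 2 ^ (16 * Nat.log 2 n) := Nat.pow_le_pow_right (by norm_num) (by omega)
    obtain ⟨A, hA⟩ := CongestedClique.exists_listing_algorithm hq (by omega) hqn
      ((Nat.lt_two_pow_self).le.trans h2p') hB H
    refine ⟨A, fun _ _ G => ?_⟩
    obtain ⟨out, hout, hunion⟩ := hA G
    refine ⟨_, out, ?_, hout, hunion⟩
    set k := ∑ i ∈ Finset.range p, CongestedClique.backDegree (CongestedClique.patternAdj H) i
    set m' := max G.edgeSet.ncard (n * q) with hm'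
    have hk : (k : ℝ) ≤ H.edgeSet.ncard := by
      exact_mod_cast CongestedClique.sum_backDegree_le H
    have hm : (m' : ℝ) ≤ CongestedClique.mTilde G p := by
      rw [hm', CongestedClique.mTilde, Nat.cast_max]
      refine max_le_max le_rfl ?_
      rw [Real.rpow_add hn0, Real.rpow_one, Nat.cast_mul]
      exact mul_le_mul_of_nonneg_left hqρ hn0.le
    have hpow : (n : ℝ) ^ (1 + 2 / (p : ℝ)) = n * ρ ^ 2 := by
      rw [Real.rpow_add hn0, Real.rpow_one, hρ, ← Real.rpow_natCast, ← Real.rpow_mul hn0.le]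
      congr 2
      push_cast
      ring
    have hdiv : ((72 * k * m' / q ^ 2 / n : ℕ) : ℝ) ≤
        288 * (H.edgeSet.ncard * CongestedClique.mTilde G p / (n : ℝ) ^ (1 + 2 / (p : ℝ))) := by
      have hρ4 : ρ ^ 2 ≤ 4 * (q : ℝ) ^ 2 := by nlinarith
      rw [hpow, Nat.div_div_eq_div_mul]
      refine Nat.cast_div_le.trans ?_
      push_cast
      rw [div_le_iff₀ (by positivity)]
      have h1 : (k : ℝ) * m' ≤ H.edgeSet.ncard * CongestedClique.mTilde G p :=
        mul_le_mul hk hm (by positivity) (by positivity)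
      have h0 : (0 : ℝ) ≤ k * m' := by positivity
      set X : ℝ := H.edgeSet.ncard * CongestedClique.mTilde G p
      have h2 : 288 * (X / (n * ρ ^ 2)) * ((q : ℝ) ^ 2 * n) = 72 * X * (4 * q ^ 2 / ρ ^ 2) := by
        field_simp
        ring
      rw [h2]
      have h3 : 1 ≤ 4 * (q : ℝ) ^ 2 / ρ ^ 2 := (one_le_div (by positivity)).mpr hρ4
      nlinarith
    push_cast at hdiv ⊢
    linarith
  choose A hA using key
  exact ⟨16, 142848, A, fun n p hp hpn H G => hA n p H hp hpn G⟩
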